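/- Let $F\in\mathbb{C}[x,y]$. Call $t\in\mathbb{C}$ \emph{typical} if, over a neighbourhood of $t$, $F$ has no critical points and is a locally trivial fibration; let $\Sigma$ be the set of atypical values. Let $t_0\notin\Sigma$ be such that $F^{-1}(t_0)$ is connected, let $p_0\in F^{-1}(t_0)$, $\pi_1=\pi_1(F^{-1}(t_0),p_0)$ and $\gamma\in\pi_1$. For a closed path $\alpha$ based at $p_0$ in $\mathbb{C}^2\setminus F^{-1}(\Sigma)$ let $Mon_\alpha(\gamma)\in\pi_1$ be the class obtained by transporting $\gamma$ along $\alpha$ through loops lying in the fibres of $F$ and based at the points of $\alpha$. Let $\mathcal{O}\lhd\pi_1$ be the smallest normal subgroup containing all $Mon_\alpha(\gamma)$, let $K=[\mathcal{O},\pi_1]$, let $H_1(\mathcal{O})=\mathcal{O}/K$ (an abelian group) and $\mathbb{C}H_1(\mathcal{O})=(\mathcal{O}/K)\otimes_{\mathbb{Z}}\mathbb{C}$. Let $L_1=\pi_1$, $L_{i+1}=[L_i,\pi_1]$ be the lower central sequence. Assume that the torsion-free orbit depth $$k=\min\Big\{j\ge1 \;\Big|\; \tfrac{K(\mathcal{O}\cap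 L_{j+1})}{K}\otimes_{\mathbb{Z}}\mathbb{C}=0\Big\}$$ of $\gamma$ is finite (that is, the set is non-empty). Let $\eta_1,\dots,\eta_n$ be polynomial one-forms on $\mathbb{C}^2$ whose restrictions form a basis of $H^1(F^{-1}(t_0);\mathbb{C})$. Let $\mathbb{C}_k=\mathbb{C}\langle X_1,\dots,X_n\rangle/\mathfrak{m}^{k+1}$, where $\mathbb{C}\langle X_1,\dots,X_n\rangle$ is the free associative algebra and $\mathfrak{m}$ is its ideal generated by $X_1,\dots,X_n$. For $\sigma\in\pi_1$ put $$II_k(\sigma)=1+\sum_{1\le\ell\le k}\ \sum_{(i_1,\dots,i_\ell)}\Big(\int_c\eta_{i_1}\cdots\eta_{i_\ell}\Big)X_{i_1}\cdots X_{i_\ell}\in\mathbb{C}_k,$$ where $c$ is a piecewise $C^1$ loop of class $\sigma$ and, if $c^*\eta_i=\varphi_i(s)\,ds$, $\int_c\eta_{i_1}\cdots\eta_{i_\ell}=\int_{0\le s_1\le\dots\le s_\ell\le1}\varphi_{i_1}(s_1)\cdots\varphi_{i_\ell}(s_\ell)\,ds_1\cdots ds_\ell$. Put $\log(1+x)=\sum_{j=1}^{k}(-1)^{j+1}x^j/j$,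 $N_1=\mathrm{Span}_{\mathbb{C}}\{\log II_k(\sigma):\sigma\in\mathcal{O}\}$ and $N_0=\mathrm{Span}_{\mathbb{C}}\{\log II_k(\sigma):\sigma\in K\}\subset N_1$. Then every class in $\pi_1$ contains a piecewise $C^1$ loop, $II_k(\sigma)$ does not depend on the choice of $c$, the map $\log\circ II_k$ is well defined on $\pi_1/L_{k+1}$, and it induces a linear isomorphism from $\mathbb{C}H_1(\mathcal{O})$ onto $N=N_1/N_0$, given by $[\sigma]\otimes1\mapsto\log II_k(\sigma)+N_0$ for $\sigma\in\mathcal{O}$. -/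

import Mathlib

open scoped TensorProduct commutatorElement

noncomputable section

namespace OrbitDepth

/-! ### Normal subgroups, their first homology, and the orbit depth -/

section Algebra

variable {G : Type} [Group G]

/-- The subgroup `K = [O, G]`, generated by the commutators of elements of `O` with elements
of `G`. -/
def K (O : Subgroup G) : Subgroup G := ⁅O, (⊤ : Subgroup G)⁆

/-- The lower central sequence with the indexing `L 1 = G`, `L (i + 1) = [L i, G]`
(and `L 0 = G` by convention). -/
def L (G : Type) [Group G] (i : ℕ) : Subgroup G := (⊤ : Subgroup G).lowerCentralSeries (i - 1)

instance L_normal (i : ℕ) : (L G i).Normal := by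
  unfold L; infer_instance

instance K_normal (O : Subgroup G) [O.Normal] : (K O).Normal := by
  unfold K; infer_instance

theorem K_le (O : Subgroup G) [O.Normal] : K O ≤ O := Subgroup.commutator_le_left O ⊤

/-- The group `H₁(O) = O / K`. -/
abbrev H1 (O : Subgroup G) [O.Normal] : Type := O ⧸ (K O).subgroupOf O

instance H1_commGroup (O : Subgroup G) [O.Normal] : CommGroup (H1 O) :=
  { (inferInstance : Group (H1 O)) with
    mul_comm := by
      intro a b
      induction a using QuotientGroup.induction_on with
      | H a =>
        induction b using QuotientGroup.induction_on with
        | H b =>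
          rw [← QuotientGroup.mk_mul, ← QuotientGroup.mk_mul, QuotientGroup.eq,
            Subgroup.mem_subgroupOf]
          have h := Subgroup.commutator_mem_commutator (H₁ := O) (H₂ := ⊤)
            (O.inv_mem b.2) (Subgroup.mem_top ((a : G)⁻¹))
          have e : (((a * b)⁻¹ * (b * a) : O) : G) = ⁅((b : G))⁻¹, ((a : G))⁻¹⁆ := by
            simp [commutatorElement_def, mul_assoc]
          rw [e]
          exact h }

/-- The complex vector space `ℂH₁(O) = (O / K) ⊗ ℂ`. -/
abbrev CH1 (O : Subgroup G) [O.Normal] : Type := ℂ ⊗[ℤ] Additive (H1 O)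

/-- The class `1 ⊗ [σ]` in `ℂH₁(O)` of an element `σ` of `O`. -/
def CH1.of (O : Subgroup G) [O.Normal] (σ : O) : CH1 O :=
  (1 : ℂ) ⊗ₜ[ℤ] Additive.ofMul (QuotientGroup.mk σ : H1 O)

/-- The subspace `O_i = (K (O ∩ L i) / K) ⊗ ℂ` of `ℂH₁(O)`. -/
def layer (O : Subgroup G) [O.Normal] (i : ℕ) : Submodule ℂ (CH1 O) :=
  Submodule.span ℂ {x | ∃ σ : O, (σ : G) ∈ L G i ∧ x = CH1.of O σ}

/-- The torsion-free orbit depth: the least `j ≥ 1` for which `O ∩ L (j + 1)` is contained in `K`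
up to torsion, i.e. `O_{j+1} = 0`; it is `⊤` if there is no such `j`. -/
def torsionFreeDepth (O : Subgroup G) [O.Normal] : ℕ∞ :=
  ⨅ j ∈ {j : ℕ | 1 ≤ j ∧ layer O (j + 1) = ⊥}, (j : ℕ∞)

end Algebra

/-! ### The polynomial fibration and the orbit under monodromy -/

/-- Polynomials in two complex variables. -/
abbrev Poly : Type := MvPolynomial (Fin 2) ℂ

/-- The affine curve `F⁻¹(t)` in `ℂ²`. -/
abbrev Fiber (F : Poly) (t : ℂ) : Type := {p : Fin 2 → ℂ // MvPolynomial.eval p F = t}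

/-- `t` is a typical value of `F`: over a neighbourhood of `t` the polynomial `F` has no critical
points and is a locally trivial fibration. The atypical values form the set `Σ`. -/
def IsTypical (F : Poly) (t : ℂ) : Prop :=
  ∃ U : Set ℂ, IsOpen U ∧ t ∈ U ∧
    (∀ p : Fin 2 → ℂ, MvPolynomial.eval p F ∈ U →
      ∃ j, MvPolynomial.eval p (MvPolynomial.pderiv j F) ≠ 0) ∧
    ∃ h : {p : Fin 2 → ℂ // MvPolynomial.eval p F ∈ U} ≃ₜ U × Fiber F t,
      ∀ x, ((h x).1 : ℂ) = MvPolynomial.eval x.1 F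

/-- The homotopy class of a loop. -/
def loopClass {X : Type} [TopologicalSpace X] {x : X} (c : Path x x) : FundamentalGroup X x :=
  FundamentalGroup.fromPath (Path.Homotopic.Quotient.mk c)

/-- `τ = Mon_α(σ)`: the class `σ` is transported to the class `τ` along a closed path `α` in
`ℂ² \ F⁻¹(Σ)`, by a continuous family `H (s, ·)` of loops, the loop `H (s, ·)` lying in the fibre
through `α s` and being based at `α s`. -/
def IsMonodromy (F : Poly) {t : ℂ} (p : Fiber F t) (α : Path p.1 p.1)
    (σ τ : FundamentalGroup (Fiber F t) p) : Prop :=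
  ∃ H : C(unitInterval × unitInterval, Fin 2 → ℂ),
    (∀ s, H (s, 0) = α s) ∧ (∀ s, H (s, 1) = α s) ∧
    (∀ s u, MvPolynomial.eval (H (s, u)) F = MvPolynomial.eval (α s) F) ∧
    (∃ c : Path p p, (∀ u, H (0, u) = (c u).1) ∧ loopClass c = σ) ∧
    (∃ c : Path p p, (∀ u, H (1, u) = (c u).1) ∧ loopClass c = τ)

/-- The orbit `O` of `γ` under monodromy: the smallest normal subgroup of the fundamental group
of the fibre containing all `Mon_α(γ)`, for all closed paths `α` in `ℂ² \ F⁻¹(Σ)`. -/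
def orbit (F : Poly) {t : ℂ} (p : Fiber F t) (γ : FundamentalGroup (Fiber F t) p) :
    Subgroup (FundamentalGroup (Fiber F t) p) :=
  Subgroup.normalClosure {τ | ∃ α : Path p.1 p.1,
    (∀ s, IsTypical F (MvPolynomial.eval (α s) F)) ∧ IsMonodromy F p α γ τ}

instance orbit_normal (F : Poly) {t : ℂ} (p : Fiber F t)
    (γ : FundamentalGroup (Fiber F t) p) : (orbit F p γ).Normal := by
  unfold orbit; infer_instance

/-! ### Iterated integrals -/

/-- A polynomial one-form `η 0 dx + η 1 dy` on `ℂ²`. -/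
abbrev PolyForm : Type := Fin 2 → Poly

/-- A path in a fibre as a map from the real line to `ℂ²`, constant outside `[0, 1]`. -/
def ambient {F : Poly} {t : ℂ} {p q : Fiber F t} (c : Path p q) (u : ℝ) : Fin 2 → ℂ :=
  (c.extend u).1

/-- Piecewise continuously differentiable paths: off finitely many parameters, the path is `C¹`
on closed intervals (with one-sided derivatives at the endpoints). -/
def IsPiecewiseC1 {F : Poly} {t : ℂ} {p q : Fiber F t} (c : Path p q) : Prop :=
  ∃ S : Finset ℝ, ∀ a b : ℝ, 0 ≤ a → a < b → b ≤ 1 → (∀ u ∈ Set.Ioo a b, u ∉ S) →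
    ContDiffOn ℝ 1 (ambient c) (Set.Icc a b)

/-- The function `φ` with `c^* η = φ(u) du`. -/
def pullback (η : PolyForm) {F : Poly} {t : ℂ} {p q : Fiber F t} (c : Path p q) (u : ℝ) : ℂ :=
  ∑ j, MvPolynomial.eval (ambient c u) (η j) * deriv (fun v => ambient c v j) u

/-- For the list `[φ_ℓ, …, φ_1]`, the integral of `φ_1(t_1) ⋯ φ_ℓ(t_ℓ)` over
`0 ≤ t_1 ≤ ⋯ ≤ t_ℓ ≤ s`, as an iterated integral. -/
def iterAux : List (ℝ → ℂ) → ℝ → ℂ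
  | [], _ => 1
  | φ :: l, s => ∫ u in (0 : ℝ)..s, iterAux l u * φ u

/-- The iterated integral `∫_c ω_1 ⋯ ω_ℓ`, with `ω_1` in the innermost integral. -/
def iterInt (ω : List PolyForm) {F : Poly} {t : ℂ} {p q : Fiber F t} (c : Path p q) : ℂ :=
  iterAux ((ω.map fun η => pullback η c).reverse) 1

/-! ### Truncated noncommutative series and the map `II_k` -/

/-- The ideal `𝔪` generated by `X_1, …, X_n` in the free associative algebra: the kernel of the
augmentation. -/
def maxIdeal (n : ℕ) : Ideal (FreeAlgebra ℂ (Fin n)) :=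
  RingHom.ker (FreeAlgebra.algebraMapInv (R := ℂ) (X := Fin n))

instance maxIdeal_twoSided (n : ℕ) : (maxIdeal n).IsTwoSided := by
  unfold maxIdeal; infer_instance

/-- The algebra `ℂ_k = ℂ⟨X_1, …, X_n⟩ / 𝔪^(k+1)` of noncommutative series truncated after
degree `k`. -/
abbrev Jets (n k : ℕ) : Type := FreeAlgebra ℂ (Fin n) ⧸ (maxIdeal n) ^ (k + 1)

/-- The variable `X_i` in `ℂ_k`. -/
def Jets.X {n : ℕ} (k : ℕ) (i : Fin n) : Jets n k :=
  Ideal.Quotient.mk ((maxIdeal n) ^ (k + 1)) (FreeAlgebra.ι ℂ i)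

/-- `log (1 + x) = x - x² / 2 + x³ / 3 - ⋯` in `ℂ_k`; the terms of degree `> k` vanish for
`x` in the image of `𝔪`. -/
def Jets.log {n k : ℕ} (a : Jets n k) : Jets n k :=
  ∑ j ∈ Finset.Icc 1 k, ((-1 : ℂ) ^ (j + 1) / (j : ℂ)) • (a - 1) ^ j

/-- The truncated Chen series of a path,
`1 + ∑_{1 ≤ ℓ ≤ k} ∑_{(i_1, …, i_ℓ)} (∫_c η_{i_1} ⋯ η_{i_ℓ}) X_{i_1} ⋯ X_{i_ℓ}`. -/
def chenSeries {n : ℕ} (k : ℕ) (η : Fin n → PolyForm) {F : Poly} {t : ℂ} {p q : Fiber F t}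
    (c : Path p q) : Jets n k :=
  1 + ∑ l ∈ Finset.Icc 1 k, ∑ w : Fin l → Fin n,
    iterInt (List.ofFn fun i => η (w i)) c • (List.ofFn fun i => Jets.X k (w i)).prod

open Classical in
/-- A piecewise `C¹` representative of a class of loops. -/
def representative {F : Poly} {t : ℂ} {p : Fiber F t} (σ : FundamentalGroup (Fiber F t) p) :
    Path p p :=
  if h : ∃ c : Path p p, IsPiecewiseC1 c ∧ loopClass c = σ then h.choose else Path.refl p

/-- The integral of a polynomial one-form over a class of loops in the fibre. -/
def period (η : PolyForm) {F : Poly} {t : ℂ} {p : Fiber F t}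
    (σ : FundamentalGroup (Fiber F t) p) : ℂ :=
  iterInt [η] (representative σ)

/-- The map `II_k` on the fundamental group of the fibre. -/
def II {n : ℕ} (k : ℕ) (η : Fin n → PolyForm) {F : Poly} {t : ℂ} {p : Fiber F t}
    (σ : FundamentalGroup (Fiber F t) p) : Jets n k :=
  chenSeries k η (representative σ)

/-- The restrictions of `η_1, …, η_n` to the (connected) fibre form a basis of its first cohomology
`H¹(F⁻¹(t); ℂ) = Hom(π₁, ℂ)`, a form being identified with its period homomorphism. -/
def IsCohomologyBasis {n : ℕ} (η : Fin n → PolyForm) {F : Poly} {t : ℂ} (p : Fiber F t) : Prop :=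
  ∀ φ : FundamentalGroup (Fiber F t) p →* Multiplicative ℂ,
    ∃! a : Fin n → ℂ, ∀ σ, Multiplicative.toAdd (φ σ) = ∑ i, a i * period (η i) σ

/-- The span of `log (II_k(A))` in `ℂ_k`, for a subgroup `A` of the fundamental group. -/
def logSpan {n : ℕ} (k : ℕ) (η : Fin n → PolyForm) {F : Poly} {t : ℂ} {p : Fiber F t}
    (A : Subgroup (FundamentalGroup (Fiber F t) p)) : Submodule ℂ (Jets n k) :=
  Submodule.span ℂ ((fun σ : FundamentalGroup (Fiber F t) p => Jets.log (II k η σ)) ''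
    (A : Set (FundamentalGroup (Fiber F t) p)))

/-- The element `log (II_k(σ))` of the span of `log (II_k(A))`, for `σ` in `A`. -/
def logSpan.of {n : ℕ} (k : ℕ) (η : Fin n → PolyForm) {F : Poly} {t : ℂ} {p : Fiber F t}
    (A : Subgroup (FundamentalGroup (Fiber F t) p)) (σ : A) : logSpan k η A :=
  ⟨Jets.log (II k η (σ : FundamentalGroup (Fiber F t) p)),
    Submodule.subset_span ⟨σ, σ.2, rfl⟩⟩

/-- The quotient `N = N₁ / N₀` of `N₁ = Span log (II_k(O))` by `N₀ = Span log (II_k(K))`, where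
`K = [O, π₁]`. -/
abbrev NSpace {n : ℕ} (k : ℕ) (η : Fin n → PolyForm) {F : Poly} {t : ℂ} {p : Fiber F t}
    (O : Subgroup (FundamentalGroup (Fiber F t) p)) : Type :=
  logSpan k η O ⧸ (logSpan k η (K O)).submoduleOf (logSpan k η O)

end OrbitDepth

end

/-!
The iterated integrals enter only through the fact that `Φ = II_k` is a truncated expansion of the
fundamental group: `Φ (σ τ) = Φ τ Φ σ`, and `Φ σ = 1 + ∑ (∫_σ η_i) X_i` modulo degree at least two
(`isExpansion_II`; the order of the factors is reversed because the product of classes of loops is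
composition of morphisms). Everything else is algebra valid for an arbitrary group `G` with an
expansion `Φ` whose linear terms form a basis of `Hom(G, ℂ)`.

*Homotopy invariance.* By the implicit function theorem a fibre without critical points is covered
by discs with a holomorphic coordinate. On a disc the iterated primitives of the forms have a
generating series `P` with `P' = P ∑ η_i X_i`, and on the overlap of two discs the quotient of the
two series is locally constant (`FiberChart.eventually_transition`). Hence they are the frames of
a bundle over the fibre with discrete structure, whose total space is a covering space
(`FlatFrames.isCoveringMap_proj`). The truncated Chen series along a piecewise `C¹` path solves
the same equation, so it describes the lift of the path to that covering space
(`isHorizontal_chenTransport`), and the homotopy lifting theorem gives both homotopy invariance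
and multiplicativity. The image of a segment of the disc replaces a continuous path inside a
chart, which gives piecewise `C¹` representatives (`exists_isPiecewiseC1_homotopic`).

*Additivity.* For a subgroup `H` and a linear functional `l` that vanishes on `log Φ [H, H]`, the
function `l ∘ log ∘ Φ` is additive on `H` (`map_truncLog_mul`). Instead of the
Baker-Campbell-Hausdorff formula the proof uses that `l (log Φ (x^m y^m))` is polynomial in `m`
with linear coefficient `l (log Φ x) + l (log Φ y)`. With `H = O` and the projection modulo `N₀`,
this makes the map `ℂH₁(O) → N₁ / N₀` well defined and linear; it is clearly surjective.

*Injectivity.* One has to show that every homomorphism `f : O → ℂ` trivial on `K` is of the form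
`l ∘ log ∘ Φ` with `l` linear (`IsExpansion.exists_functional_of_orbit`). Since the depth is `k`,
the function `f` vanishes on `O ∩ L (k + 1)`. Suppose that `l` is already correct on `O ∩ L (j +
1)`. By additivity, the error on `O ∩ L j` is a homomorphism that vanishes on `O ∩ L (j + 1)`, and
it extends to a homomorphism `h : L j → ℂ` that vanishes on `L (j + 1)`, since `ℂ` is divisible.
Every such `h` is of the form `l' ∘ log ∘ Φ` on `L j` (`IsExpansion.exists_functional`): on `L j`
the lowest order term of `log Φ` is a Lie element of degree `j`, and by Dynkin's formula the
functional that takes a word to the corresponding coefficient of the multiadditive function `(v_1,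
…, v_j) ↦ h [… [v_1, v_2], …, v_j]` takes the value `j h (σ)` on it
(`IsExpansion.jetAct_dynkinCoeff`).
-/

open scoped TensorProduct commutatorElement

noncomputable section

namespace OrbitDepth

/-! ### The truncated logarithm -/

section TruncLog

open Polynomial

variable {A : Type*} [Ring A] [Algebra ℂ A]

/-- The polynomial `∑_{1 ≤ j ≤ k} (-1)^(j+1) x^j / j`, evaluated at `x = a - 1`. -/
def truncLog (k : ℕ) (a : A) : A :=
  ∑ j ∈ Finset.Icc 1 k, ((-1 : ℂ) ^ (j + 1) / (j : ℂ)) • (a - 1) ^ j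

@[simp]
theorem truncLog_one (k : ℕ) : truncLog k (1 : A) = 0 := by
  refine Finset.sum_eq_zero fun j hj => ?_
  rw [sub_self, zero_pow (by have := (Finset.mem_Icc.1 hj).1; omega), smul_zero]

theorem map_truncLog {B : Type*} [Ring B] [Algebra ℂ B] (f : A →ₐ[ℂ] B) (k : ℕ) (a : A) :
    f (truncLog k a) = truncLog k (f a) := by
  simp [truncLog, map_sum]

/-- The differential equation `(1 + y) (log (1 + y))' = y'`, up to the truncation error. -/
theorem derivative_truncLog (k : ℕ) (y : ℂ[X]) :
    derivative (truncLog k (1 + y)) * (1 + y) = derivative y * (1 - (-y) ^ k) := by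
  induction k with
  | zero => simp [truncLog]
  | succ k ih =>
    have h : truncLog (k + 1) (1 + y) =
        truncLog k (1 + y) + ((-1 : ℂ) ^ (k + 2) / ((k + 1 : ℕ) : ℂ)) • y ^ (k + 1) := by
      simp [truncLog, Finset.sum_Icc_succ_top]
    have h2 : derivative (((-1 : ℂ) ^ (k + 2) / ((k + 1 : ℕ) : ℂ)) • y ^ (k + 1)) =
        (-y) ^ k * derivative y := by
      have hk : ((k + 1 : ℕ) : ℂ) ≠ 0 := by exact_mod_cast k.succ_ne_zero
      rw [derivative_smul, derivative_pow, neg_pow y, Nat.add_sub_cancel, smul_eq_C_mul,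
        ← mul_assoc, ← mul_assoc, ← C_mul, div_mul_cancel₀ _ hk, pow_add]
      simp
    rw [h, derivative_add, add_mul, ih, h2]
    ring

/-- The identity `log ((1 + X)^m) = m log (1 + X)` up to order `k`: both sides vanish at `0` and
their derivatives agree up to order `k - 1`. -/
theorem X_pow_dvd_truncLog_pow (k m : ℕ) :
    (X : ℂ[X]) ^ (k + 1) ∣ truncLog k ((1 + X) ^ m) - m • truncLog k (1 + X) := by
  rcases Nat.eq_zero_or_pos m with rfl | hm
  · simp
  set P : ℂ[X] := truncLog k ((1 + X) ^ m) - m • truncLog k (1 + X) with hP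
  set Y : ℂ[X] := (1 + X) ^ m - 1 with hY
  have hXY : (X : ℂ[X]) ∣ Y := by
    have := sub_dvd_pow_sub_pow (1 + X : ℂ[X]) 1 m
    simpa [hY] using this
  have hY1 : (1 + X : ℂ[X]) ^ m = 1 + Y := by rw [hY]; ring
  have hdY : derivative Y = (m : ℂ[X]) * (1 + X) ^ (m - 1) := by
    simp [hY, derivative_pow]
  have e1 := derivative_truncLog k Y
  have e2 := derivative_truncLog k (X : ℂ[X])
  rw [derivative_X, one_mul] at e2
  have hpow : (1 + X : ℂ[X]) ^ m = (1 + X) ^ (m - 1) * (1 + X) := by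
    rw [← pow_succ]; congr 1; omega
  have key : (1 + X : ℂ[X]) ^ m * derivative P =
      (m : ℂ[X]) * (1 + X) ^ (m - 1) * ((-X) ^ k - (-Y) ^ k) := by
    rw [hP, derivative_sub, hY1, nsmul_eq_mul, derivative_mul, derivative_natCast, zero_mul,
      zero_add]
    calc (1 + Y) * (derivative (truncLog k (1 + Y)) - (m : ℂ[X]) * derivative (truncLog k (1 + X)))
        = derivative (truncLog k (1 + Y)) * (1 + Y)
          - (m : ℂ[X]) * (1 + X) ^ (m - 1) * (derivative (truncLog k (1 + X)) * (1 + X)) := by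
          rw [← hY1, hpow]; ring
      _ = _ := by rw [e1, e2, hdY]; ring
  have hdvd : (X : ℂ[X]) ^ k ∣ derivative P := by
    have hcop : IsCoprime ((X : ℂ[X]) ^ k) ((1 + X) ^ m) := by
      apply IsCoprime.pow
      exact ⟨-1, 1, by ring⟩
    refine hcop.dvd_of_dvd_mul_left ?_
    rw [key]
    refine Dvd.dvd.mul_left (dvd_sub ?_ ?_) _
    · rw [neg_pow]; exact Dvd.intro_left _ rfl
    · rw [neg_pow Y]; exact Dvd.dvd.mul_left (pow_dvd_pow_of_dvd hXY k) _
  rw [X_pow_dvd_iff] at hdvd ⊢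
  intro d hd
  rcases d with _ | d
  · rw [coeff_zero_eq_eval_zero]
    have h0 : ∀ q : ℂ[X], q.eval 0 = 1 → (truncLog k q).eval 0 = 0 := by
      intro q hq
      have := map_truncLog (aeval (0 : ℂ)) k q
      simp only [coe_aeval_eq_eval] at this
      rw [this, hq, truncLog_one]
    rw [hP, eval_sub, eval_smul, h0 _ (by simp), h0 _ (by simp)]
    simp
  · have := hdvd d (by omega)
    rw [coeff_derivative] at this
    exact (mul_eq_zero.1 this).resolve_right (by exact_mod_cast d.succ_ne_zero)

theorem truncLog_pow {k : ℕ} {a : A} (ha : (a - 1) ^ (k + 1) = 0) (m : ℕ) :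
    truncLog k (a ^ m) = m • truncLog k a := by
  obtain ⟨q, hq⟩ := X_pow_dvd_truncLog_pow k m
  have := congrArg (aeval (a - 1)) hq
  rw [map_mul, map_pow, aeval_X, ha, zero_mul, map_sub, map_nsmul, map_truncLog,
    map_truncLog] at this
  simpa [sub_eq_zero] using this

/-- Evaluation of polynomials over a possibly noncommutative ring at a natural number. -/
def evalNat (A : Type*) [Ring A] (m : ℕ) : A[X] →+* A :=
  eval₂RingHom' (RingHom.id A) (m : A) fun a => Nat.commute_cast a m

theorem evalNat_apply (m : ℕ) (p : A[X]) :
    evalNat A m p = p.sum fun i c => ((m : ℂ) ^ i) • c := by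
  change eval₂ (RingHom.id A) (m : A) p = _
  rw [eval₂_eq_sum]
  refine Finset.sum_congr rfl fun i _ => ?_
  change p.coeff i * (m : A) ^ i = (m : ℂ) ^ i • p.coeff i
  rw [Algebra.smul_def, map_pow, map_natCast]
  exact (Nat.commute_cast _ _).pow_right i |>.eq

theorem coeff_one_descPochhammer (i : ℕ) :
    (descPochhammer ℂ (i + 1)).coeff 1 = (-1) ^ i * (i.factorial : ℂ) := by
  have h := ascPochhammer_eval_neg_eq_descPochhammer ℂ (-1 : ℂ) i
  rw [neg_neg, ascPochhammer_eval_one] at h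
  have h2 : (descPochhammer ℂ i).eval (-1) = (-1) ^ i * (i.factorial : ℂ) := by
    rw [h, ← mul_assoc, ← mul_pow]; simp
  rw [descPochhammer_succ_left, coeff_X_mul, coeff_zero_eq_eval_zero, eval_comp]
  simpa using h2

/-- The powers `a ^ m` of a unipotent element are the values of a polynomial in `m` with constant
term `1` and linear term `log a`: expand `(1 + x) ^ m` by the binomial theorem. -/
theorem exists_polynomial_pow {k : ℕ} {a : A} (ha : (a - 1) ^ (k + 1) = 0) :
    ∃ p : A[X], p.coeff 0 = 1 ∧ p.coeff 1 = truncLog k a ∧ ∀ m, evalNat A m p = a ^ m := by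
  let b : ℕ → A[X] := fun i =>
    ((descPochhammer ℂ i).map (algebraMap ℂ A)) * C (((i.factorial : ℂ)⁻¹) • (a - 1) ^ i)
  have hb0 : ∀ i, (b (i + 1)).coeff 0 = 0 := fun i => by
    simp [b, descPochhammer_succ_left]
  have hb1 : ∀ i, (b (i + 1)).coeff 1 =
      ((-1 : ℂ) ^ (i + 1 + 1) / ((i + 1 : ℕ) : ℂ)) • (a - 1) ^ (i + 1) := fun i => by
    have hi : (i.factorial : ℂ) ≠ 0 := by exact_mod_cast i.factorial_ne_zero
    have hi' : ((i : ℂ) + 1) ≠ 0 := by exact_mod_cast i.succ_ne_zero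
    simp only [b]
    rw [coeff_mul_C, coeff_map, coeff_one_descPochhammer, ← Algebra.smul_def, smul_smul]
    congr 1
    rw [Nat.factorial_succ]
    push_cast
    field_simp
    ring
  have hev : ∀ i m, evalNat A m (b i) = (m.choose i : ℂ) • (a - 1) ^ i := fun i m => by
    have h1 : evalNat A m ((descPochhammer ℂ i).map (algebraMap ℂ A)) =
        algebraMap ℂ A (m.descFactorial i : ℂ) := by
      change eval₂ (RingHom.id A) (m : A) _ = _
      rw [eval₂_map, RingHom.id_comp, ← descPochhammer_eval_eq_descFactorial ℂ m i,
        eval₂_at_natCast]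
    have h2 : evalNat A m (C (((i.factorial : ℂ)⁻¹) • (a - 1) ^ i)) =
        ((i.factorial : ℂ)⁻¹) • (a - 1) ^ i := by
      change eval₂ (RingHom.id A) (m : A) _ = _
      rw [eval₂_C, RingHom.id_apply]
    simp only [b]
    rw [map_mul, h1, h2, ← Algebra.smul_def, smul_smul]
    congr 1
    rw [Nat.choose_eq_descFactorial_div_factorial,
      Nat.cast_div (Nat.factorial_dvd_descFactorial _ _)
        (by exact_mod_cast i.factorial_ne_zero), div_eq_mul_inv]
  refine ⟨∑ i ∈ Finset.range (k + 1), b i, ?_, ?_, fun m => ?_⟩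
  · rw [finsetSum_coeff, Finset.sum_range_succ', Finset.sum_eq_zero fun i _ => hb0 i]
    simp [b]
  · rw [finsetSum_coeff, Finset.sum_range_succ', Finset.sum_congr rfl fun i _ => hb1 i, truncLog,
      Finset.range_eq_Ico, Finset.sum_Ico_add' (fun i => ((-1 : ℂ) ^ (i + 1) / ((i : ℕ) : ℂ)) •
        (a - 1) ^ i)]
    have : (b 0).coeff 1 = 0 := by simp [b, coeff_one]
    rw [this, add_zero]
    rfl
  · rw [map_sum, Finset.sum_congr rfl fun i _ => hev i m]
    conv_rhs => rw [← sub_add_cancel a 1, (Commute.one_right (a - 1)).add_pow]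
    rw [← Finset.sum_subset_zero_on_sdiff (s₁ := Finset.range (min (k + 1) (m + 1)))
      (s₂ := Finset.range (k + 1)) (f := fun i => (m.choose i : ℂ) • (a - 1) ^ i) ?_ ?_
      (fun _ _ => rfl)]
    · rw [← Finset.sum_subset_zero_on_sdiff (s₁ := Finset.range (min (k + 1) (m + 1)))
        (s₂ := Finset.range (m + 1)) ?_ ?_ (fun _ _ => rfl)]
      · refine Finset.sum_congr rfl fun i _ => ?_
        rw [one_pow, mul_one, Algebra.smul_def, map_natCast]
        exact Nat.cast_commute _ _
      · exact Finset.range_mono (min_le_right _ _)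
      · intro i hi
        simp only [Finset.mem_sdiff, Finset.mem_range, lt_min_iff, not_and_or, not_lt] at hi
        have : k + 1 ≤ i := by omega
        rw [pow_eq_zero_of_le this ha, zero_mul, zero_mul]
    · exact Finset.range_mono (min_le_left _ _)
    · intro i hi
      simp only [Finset.mem_sdiff, Finset.mem_range, lt_min_iff, not_and_or, not_lt] at hi
      rw [Nat.choose_eq_zero_of_lt (by omega)]
      simp

theorem coeff_one_mul {R : Type*} [Ring R] (p q : R[X]) :
    (p * q).coeff 1 = p.coeff 0 * q.coeff 1 + p.coeff 1 * q.coeff 0 := by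
  rw [coeff_mul, Finset.Nat.antidiagonal_succ]
  simp

/-- The logarithm of a product `b ^ m * a ^ m` of powers of unipotent elements is polynomial in
`m`, with linear term `log a + log b`. -/
theorem exists_polynomial_truncLog {k : ℕ} (hk : 1 ≤ k) {a b : A} (ha : (a - 1) ^ (k + 1) = 0)
    (hb : (b - 1) ^ (k + 1) = 0) :
    ∃ p : A[X], p.coeff 1 = truncLog k a + truncLog k b ∧
      ∀ m, evalNat A m p = truncLog k (b ^ m * a ^ m) := by
  obtain ⟨p, hp0, hp1, hp⟩ := exists_polynomial_pow ha
  obtain ⟨q, hq0, hq1, hq⟩ := exists_polynomial_pow hb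
  set r := q * p - 1 with hr
  have hr0 : r.coeff 0 = 0 := by simp [hr, mul_coeff_zero, hp0, hq0]
  have hr1 : r.coeff 1 = truncLog k a + truncLog k b := by
    rw [hr, coeff_sub, coeff_one_mul, hp0, hp1, hq0, hq1]
    simp [coeff_one]
  have hrj : ∀ j, (r ^ (j + 2)).coeff 1 = 0 := fun j => by
    rw [pow_succ', pow_succ', coeff_one_mul, hr0]
    simp [mul_coeff_zero, hr0]
  refine ⟨∑ j ∈ Finset.Icc 1 k, C (algebraMap ℂ A ((-1 : ℂ) ^ (j + 1) / (j : ℂ))) * r ^ j, ?_,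
    fun m => ?_⟩
  · rw [finsetSum_coeff, Finset.sum_eq_single_of_mem 1 (Finset.mem_Icc.2 ⟨le_rfl, hk⟩), coeff_C_mul,
      pow_one, hr1]
    · simp
    · intro j hj hj1
      obtain ⟨i, rfl⟩ : ∃ i, j = i + 2 := ⟨j - 2, by have := (Finset.mem_Icc.1 hj).1; omega⟩
      rw [coeff_C_mul, hrj, mul_zero]
  · rw [map_sum, truncLog]
    refine Finset.sum_congr rfl fun j _ => ?_
    rw [map_mul, map_pow, hr, map_sub, map_mul, map_one, hp, hq, Algebra.smul_def]
    congr 1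
    change eval₂ (RingHom.id A) (m : A) _ = _
    rw [eval₂_C, RingHom.id_apply]

/-- If the values of a linear image of a polynomial at natural numbers are `m • v`, then `v` is the
image of the linear coefficient. -/
theorem eq_coeff_one_of_evalNat {W : Type*} [AddCommGroup W] [Module ℂ W] (l : A →ₗ[ℂ] W)
    (p : A[X]) (v : W) (h : ∀ m : ℕ, l (evalNat A m p) = m • v) : v = l (p.coeff 1) := by
  rw [← sub_eq_zero, ← Module.forall_dual_apply_eq_zero_iff ℂ]
  intro μ
  let P : ℂ[X] := p.sum fun i c => monomial i (μ (l c))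
  have hP : P = C (μ v) * X := by
    refine Polynomial.eq_of_infinite_eval_eq _ _
      (Set.infinite_of_injective_forall_mem (f := fun m : ℕ => (m : ℂ)) Nat.cast_injective ?_)
    intro m
    have := congrArg μ (h m)
    rw [evalNat_apply, Polynomial.sum, map_sum, map_sum, map_nsmul] at this
    simp only [Set.mem_ofPred_eq, P, Polynomial.sum, eval_finsetSum, eval_monomial, eval_mul,
      eval_C, eval_X]
    simp only [map_smul, smul_eq_mul, nsmul_eq_mul] at this
    rw [mul_comm (μ v), ← this]
    exact Finset.sum_congr rfl fun i _ => mul_comm _ _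
  have h1 : P.coeff 1 = μ (l (p.coeff 1)) := by
    simp only [P, Polynomial.sum, finsetSum_coeff, coeff_monomial]
    rw [Finset.sum_ite_eq']
    split_ifs with hm
    · rfl
    · rw [notMem_support_iff.1 hm]; simp
  rw [map_sub, ← h1, hP]
  simp

end TruncLog

/-! ### Additivity of the logarithm modulo commutators -/

section Additivity

/-- Collection of powers: if `y` lies in the `j`-th term of the lower central series, then
`(x y)^m = x^m y^m z` with `z` in the next term. -/
theorem mul_pow_collect {H : Type*} [Group H] (j : ℕ) (x : H) {y : H}
    (hy : y ∈ (⊤ : Subgroup H).lowerCentralSeries j) (m : ℕ) :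
    ∃ z ∈ (⊤ : Subgroup H).lowerCentralSeries (j + 1), x ^ m * y ^ m = (x * y) ^ m * z := by
  refine ⟨((x * y) ^ m)⁻¹ * (x ^ m * y ^ m), ?_, by group⟩
  rw [← QuotientGroup.eq_one_iff]
  have hc : Commute (x : H ⧸ (⊤ : Subgroup H).lowerCentralSeries (j + 1)) y := by
    change (x : H ⧸ (⊤ : Subgroup H).lowerCentralSeries (j + 1)) * y = y * x
    rw [← QuotientGroup.mk_mul, ← QuotientGroup.mk_mul, eq_comm, QuotientGroup.eq]
    have h := Subgroup.commutator_mem_commutator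
      (Subgroup.inv_mem _ ((Subgroup.inv_mem _ hy))) (Subgroup.mem_top x)
    have h2 : (y * x)⁻¹ * (x * y) = (y * x)⁻¹ * ⁅y, x⁆⁻¹ * (y * x) := by
      rw [commutatorElement_def]; group
    rw [h2]
    have h3 : ⁅y, x⁆⁻¹ ∈ (⊤ : Subgroup H).lowerCentralSeries (j + 1) := by
      rw [inv_inv] at h
      exact Subgroup.inv_mem _ h
    simpa using (inferInstance :
      ((⊤ : Subgroup H).lowerCentralSeries (j + 1)).Normal).conj_mem _ h3 (y * x)⁻¹
  rw [QuotientGroup.mk_mul, QuotientGroup.mk_inv, QuotientGroup.mk_pow, QuotientGroup.mk_mul,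
    QuotientGroup.mk_mul, QuotientGroup.mk_pow, QuotientGroup.mk_pow, hc.mul_pow]
  group

/-- A linear functional of `log Φ`, where `Φ` is a unipotent (anti-)representation, which vanishes
on commutators, is additive. The proof replaces the Baker-Campbell-Hausdorff formula by a
polynomiality argument: `log Φ(x^m y^m)` is polynomial in `m` with linear term
`log Φ(x) + log Φ(y)`, and, modulo deeper commutators, it is `m log Φ(x y)`. -/
theorem map_truncLog_mul {H : Type*} [Group H] {A : Type*} [Ring A] [Algebra ℂ A]
    {W : Type*} [AddCommGroup W] [Module ℂ W] {k : ℕ} (hk : 1 ≤ k) (Φ : H → A)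
    (hmul : ∀ g h, Φ (g * h) = Φ h * Φ g) (hnil : ∀ g, (Φ g - 1) ^ (k + 1) = 0)
    (hΦ : ∀ g ∈ (⊤ : Subgroup H).lowerCentralSeries k, Φ g = 1) (l : A →ₗ[ℂ] W)
    (hl : ∀ g ∈ commutator H, l (truncLog k (Φ g)) = 0) (x y : H) :
    l (truncLog k (Φ (x * y))) = l (truncLog k (Φ x)) + l (truncLog k (Φ y)) := by
  have h1 : Φ 1 = 1 := hΦ 1 (Subgroup.one_mem _)
  have hpow : ∀ g (m : ℕ), Φ (g ^ m) = Φ g ^ m := fun g m => by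
    induction m with
    | zero => simp [h1]
    | succ m ih => rw [pow_succ, hmul, ih, ← pow_succ']
  -- Descending induction on the depth `j` of `y`; the element `z` collected from `(x y)^m` is
  -- deeper than `y`, so that its contribution is known to be additive, and it is a commutator.
  suffices h : ∀ d j, j + d = k → ∀ x y : H, y ∈ (⊤ : Subgroup H).lowerCentralSeries j →
      l (truncLog k (Φ (x * y))) = l (truncLog k (Φ x)) + l (truncLog k (Φ y)) from
    h k 0 (by simp) x y (Subgroup.mem_top y)
  intro d
  induction d with
  | zero =>
    intro j hj x y hy
    have hy1 : Φ y = 1 := hΦ y (by rwa [← hj])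
    rw [hmul, hy1, one_mul, truncLog_one, map_zero, add_zero]
  | succ d ih =>
    intro j hj x y hy
    obtain ⟨p, hp1, hp⟩ := exists_polynomial_truncLog hk (hnil x) (hnil y)
    rw [← map_add, ← hp1]
    refine eq_coeff_one_of_evalNat l p _ fun m => ?_
    obtain ⟨z, hz, hxy⟩ := mul_pow_collect j x hy m
    have hz' : z ∈ commutator H := by
      have := (⊤ : Subgroup H).lowerCentralSeries_antitone (show 1 ≤ j + 1 by omega) hz
      rwa [Subgroup.top_lowerCentralSeries_one] at this
    rw [hp, ← hpow, ← hpow, ← hmul, hxy, ih (j + 1) (by omega) _ _ hz, hl z hz', add_zero, hpow,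
      truncLog_pow (hnil _), map_nsmul]

end Additivity

/-! ### The filtration of the jet algebra by order -/

section Jets

variable {n k : ℕ}

/-- The image of `𝔪 ^ j` in `ℂ_k`: the jets of order at least `j`. -/
def jetFil (n k j : ℕ) : Submodule ℂ (Jets n k) :=
  ((maxIdeal n ^ j).restrictScalars ℂ).map
    (Ideal.Quotient.mkₐ ℂ (maxIdeal n ^ (k + 1))).toLinearMap

theorem mem_jetFil {j : ℕ} {x : Jets n k} :
    x ∈ jetFil n k j ↔
      ∃ y ∈ maxIdeal n ^ j, Ideal.Quotient.mk (maxIdeal n ^ (k + 1)) y = x :=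
  Iff.rfl

theorem jetFil_zero : jetFil n k 0 = ⊤ := by
  refine eq_top_iff.2 fun x _ => ?_
  obtain ⟨y, rfl⟩ := Ideal.Quotient.mk_surjective x
  refine mem_jetFil.2 ⟨y, ?_, rfl⟩
  rw [Submodule.pow_zero, Ideal.one_eq_top]
  trivial

theorem jetFil_antitone : Antitone (jetFil n k) := by
  rintro i j hij x hx
  obtain ⟨y, hy, rfl⟩ := mem_jetFil.1 hx
  exact mem_jetFil.2 ⟨y, Ideal.pow_le_pow_right hij hy, rfl⟩

theorem mul_mem_jetFil {i j : ℕ} {x y : Jets n k} (hx : x ∈ jetFil n k i)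
    (hy : y ∈ jetFil n k j) : x * y ∈ jetFil n k (i + j) := by
  obtain ⟨a, ha, rfl⟩ := mem_jetFil.1 hx
  obtain ⟨b, hb, rfl⟩ := mem_jetFil.1 hy
  refine mem_jetFil.2 ⟨a * b, ?_, map_mul _ _ _⟩
  rw [Ideal.IsTwoSided.pow_add]
  exact Ideal.mul_mem_mul ha hb

theorem mul_mem_jetFil_of_eq {i j l : ℕ} (h : i + j = l) {x y : Jets n k}
    (hx : x ∈ jetFil n k i) (hy : y ∈ jetFil n k j) : x * y ∈ jetFil n k l :=
  h ▸ mul_mem_jetFil hx hy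

theorem mul_mem_jetFil_right {i : ℕ} {x : Jets n k} (hx : x ∈ jetFil n k i) (y : Jets n k) :
    y * x ∈ jetFil n k i :=
  mul_mem_jetFil_of_eq (zero_add i) (jetFil_zero (n := n) (k := k) ▸ trivial) hx

theorem eq_zero_of_mem_jetFil {j : ℕ} (hj : k < j) {x : Jets n k} (hx : x ∈ jetFil n k j) :
    x = 0 := by
  obtain ⟨y, hy, rfl⟩ := mem_jetFil.1 (jetFil_antitone (Nat.succ_le_of_lt hj) hx)
  exact Ideal.Quotient.eq_zero_iff_mem.2 hy

theorem pow_mem_jetFil {i : ℕ} {x : Jets n k} (hx : x ∈ jetFil n k i) (m : ℕ) :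
    x ^ m ∈ jetFil n k (m * i) := by
  induction m with
  | zero => rw [zero_mul, jetFil_zero]; trivial
  | succ m ih => rw [pow_succ, Nat.succ_mul]; exact mul_mem_jetFil ih hx

theorem X_mem_jetFil (a : Fin n) : Jets.X k a ∈ jetFil n k 1 :=
  mem_jetFil.2 ⟨FreeAlgebra.ι ℂ a, by
    rw [Submodule.pow_one]
    simp [maxIdeal, FreeAlgebra.algebraMapInv], rfl⟩

theorem sub_one_pow_eq_zero {a : Jets n k} (ha : a - 1 ∈ jetFil n k 1) :
    (a - 1) ^ (k + 1) = 0 :=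
  eq_zero_of_mem_jetFil (by omega) (pow_mem_jetFil ha (k + 1))

theorem truncLog_sub_mem (hk : 1 ≤ k) {a : Jets n k} {j : ℕ} (hj : 1 ≤ j)
    (ha : a - 1 ∈ jetFil n k j) : truncLog k a - (a - 1) ∈ jetFil n k (j + 1) := by
  have h : truncLog k a - (a - 1) =
      ∑ i ∈ Finset.Icc 2 k, ((-1 : ℂ) ^ (i + 1) / (i : ℂ)) • (a - 1) ^ i := by
    rw [truncLog, ← Finset.add_sum_Ioc_eq_sum_Icc hk]
    simp only [pow_one]
    rw [show Finset.Icc 2 k = Finset.Ioc 1 k from rfl]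
    simp
  rw [h]
  refine Submodule.sum_mem _ fun i hi => Submodule.smul_mem _ _ ?_
  refine jetFil_antitone ?_ (pow_mem_jetFil ha i)
  have := (Finset.mem_Icc.1 hi).1
  nlinarith

end Jets

/-! ### The action of jets on functions of words -/

section Operators

variable {n : ℕ} (k : ℕ)

/-- The variable `X_a` acts on functions of words by `(X_a f)(w) = f(a w)`, truncated to words `w`
for which `a w` has length at most `k`. -/
def shift (a : Fin n) : Module.End ℂ (List (Fin n) → ℂ) where
  toFun f w := if w.length + 1 ≤ k then f (a :: w) else 0
  map_add' f g := by ext w; simp only [Pi.add_apply]; split_ifs <;> simp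
  map_smul' c f := by ext w; simp

theorem shift_apply (a : Fin n) (f : List (Fin n) → ℂ) (w : List (Fin n)) :
    shift k a f w = if w.length + 1 ≤ k then f (a :: w) else 0 := rfl

/-- The action of the free algebra on functions of words. -/
def freeAct (n k : ℕ) : FreeAlgebra ℂ (Fin n) →ₐ[ℂ] Module.End ℂ (List (Fin n) → ℂ) :=
  FreeAlgebra.lift ℂ (shift k)

/-- The action of a noncommutative polynomial without constant term involves longer words only. -/
theorem freeAct_sub_eq_zero (x : FreeAlgebra ℂ (Fin n)) :
    ∀ (f : List (Fin n) → ℂ) (w : List (Fin n)),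
      (∀ v : List (Fin n), w.length + 1 ≤ v.length → v.length ≤ k → f v = 0) →
      freeAct n k x f w = FreeAlgebra.algebraMapInv x * f w := by
  induction x using FreeAlgebra.induction with
  | grade0 r =>
    intro f w _
    simp [Module.algebraMap_end_apply, FreeAlgebra.algebraMapInv]
  | grade1 a =>
    intro f w h
    simp only [freeAct, FreeAlgebra.lift_ι_apply, shift_apply, FreeAlgebra.algebraMapInv]
    split_ifs with hw
    · rw [h (a :: w) (by simp) (by simpa using hw)]
      simp
    · simp
  | mul x y hx hy =>
    intro f w h
    have hy' : ∀ v : List (Fin n), w.length ≤ v.length →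
        freeAct n k y f v = FreeAlgebra.algebraMapInv y * f v := fun v hv =>
      hy f v fun u hu huk => h u (by omega) huk
    rw [map_mul, Module.End.mul_apply, hx _ w, hy' w le_rfl, map_mul, mul_assoc]
    intro v hv hvk
    rw [hy' v (by omega), h v hv hvk, mul_zero]
  | add x y hx hy =>
    intro f w h
    rw [map_add, LinearMap.add_apply, Pi.add_apply, hx f w h, hy f w h, map_add, add_mul]

theorem freeAct_eq_zero (j : ℕ) :
    ∀ (x : FreeAlgebra ℂ (Fin n)), x ∈ maxIdeal n ^ (j + 1) →
      ∀ (f : List (Fin n) → ℂ) (w : List (Fin n)),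
      (∀ v : List (Fin n), w.length + (j + 1) ≤ v.length → v.length ≤ k → f v = 0) →
      freeAct n k x f w = 0 := by
  have h1 : ∀ (x : FreeAlgebra ℂ (Fin n)), x ∈ maxIdeal n →
      ∀ (f : List (Fin n) → ℂ) (w : List (Fin n)),
      (∀ v : List (Fin n), w.length + 1 ≤ v.length → v.length ≤ k → f v = 0) →
      freeAct n k x f w = 0 := fun x hx f w h => by
    rw [freeAct_sub_eq_zero k x f w h, show FreeAlgebra.algebraMapInv x = (0 : ℂ) from hx, zero_mul]
  induction j with
  | zero => simpa [Submodule.pow_one] using h1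
  | succ j ih =>
    intro x hx f w h
    rw [Submodule.pow_succ] at hx
    refine Submodule.mul_induction_on hx (fun a ha b hb => ?_) fun x y hx hy => ?_
    · rw [map_mul, Module.End.mul_apply]
      refine ih a ha _ w fun v hv hvk => h1 b hb f v fun u hu huk => h u (by omega) huk
    · rw [map_add, LinearMap.add_apply, Pi.add_apply, hx, hy, add_zero]

/-- The action of the jet algebra on functions of words. -/
def jetAct (n k : ℕ) : Jets n k →ₐ[ℂ] Module.End ℂ (List (Fin n) → ℂ) :=
  Ideal.Quotient.liftₐ (maxIdeal n ^ (k + 1)) (freeAct n k) fun x hx => by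
    refine LinearMap.ext fun f => funext fun w => ?_
    exact freeAct_eq_zero k k x hx f w fun v hv hvk => by omega

theorem jetAct_X (a : Fin n) (f : List (Fin n) → ℂ) (w : List (Fin n)) :
    jetAct n k (Jets.X k a) f w = if w.length + 1 ≤ k then f (a :: w) else 0 := by
  have : jetAct n k (Jets.X k a) = freeAct n k (FreeAlgebra.ι ℂ a) := rfl
  rw [this, freeAct, FreeAlgebra.lift_ι_apply, shift_apply]

theorem jetAct_eq_zero {j : ℕ} (hj : 1 ≤ j) {x : Jets n k} (hx : x ∈ jetFil n k j)
    {f : List (Fin n) → ℂ} {w : List (Fin n)}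
    (h : ∀ v : List (Fin n), w.length + j ≤ v.length → f v = 0) : jetAct n k x f w = 0 := by
  obtain ⟨y, hy, rfl⟩ := mem_jetFil.1 hx
  obtain ⟨i, rfl⟩ : ∃ i, j = i + 1 := ⟨j - 1, by omega⟩
  exact freeAct_eq_zero k i y hy f w fun v hv _ => h v hv

/-- The action of a jet of order `j` on `f` at the word `w` depends only on the values of `f` at
words of length at least `|w| + j`. -/
theorem jetAct_congr {j : ℕ} (hj : 1 ≤ j) {x : Jets n k} (hx : x ∈ jetFil n k j)
    {f g : List (Fin n) → ℂ} {w : List (Fin n)}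
    (h : ∀ v : List (Fin n), w.length + j ≤ v.length → f v = g v) :
    jetAct n k x f w = jetAct n k x g w := by
  rw [← sub_eq_zero, ← Pi.sub_apply, ← map_sub]
  exact jetAct_eq_zero k hj hx fun v hv => by simp [h v hv]

end Operators

/-! ### Additive functionals on the lower central quotients -/

section Lower

variable {G : Type} [Group G]

theorem L_succ {i : ℕ} (hi : 1 ≤ i) : L G (i + 1) = ⁅L G i, (⊤ : Subgroup G)⁆ := by
  obtain ⟨j, rfl⟩ : ∃ j, i = j + 1 := ⟨i - 1, by omega⟩
  rfl

theorem L_antitone : Antitone (L G) := fun _ _ h =>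
  Subgroup.lowerCentralSeries_antitone _ (Nat.sub_le_sub_right h 1)

/-- The three subgroups lemma relative to a normal subgroup. -/
theorem commutator_commutator_le_of_rotate {H₁ H₂ H₃ N : Subgroup G} [N.Normal]
    (h1 : ⁅⁅H₂, H₃⁆, H₁⁆ ≤ N) (h2 : ⁅⁅H₃, H₁⁆, H₂⁆ ≤ N) : ⁅⁅H₁, H₂⁆, H₃⁆ ≤ N := by
  have key : ∀ H : Subgroup G, H ≤ N ↔ H.map (QuotientGroup.mk' N) = ⊥ := fun H => by
    rw [Subgroup.map_eq_bot_iff, QuotientGroup.ker_mk']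
  rw [key] at *
  simp only [Subgroup.map_commutator] at *
  exact Subgroup.commutator_commutator_eq_bot_of_rotate h1 h2

theorem commutator_L_le (i j : ℕ) (hi : 1 ≤ i) (hj : 1 ≤ j) : ⁅L G i, L G j⁆ ≤ L G (i + j) := by
  induction j, hj using Nat.le_induction generalizing i with
  | base => rw [L_succ hi]; exact Subgroup.commutator_mono le_rfl le_top
  | succ j hj ih =>
    rw [Subgroup.commutator_comm, L_succ hj]
    refine commutator_commutator_le_of_rotate ?_ ?_
    · rw [Subgroup.commutator_comm ⊤, ← L_succ hi, show i + (j + 1) = i + 1 + j by ring]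
      exact ih (i + 1) (by omega)
    · rw [← add_assoc, L_succ (by omega)]
      exact Subgroup.commutator_mono (ih i hi) le_rfl

theorem commutator_mem_L {i j : ℕ} (hi : 1 ≤ i) (hj : 1 ≤ j) {a b : G} (ha : a ∈ L G i)
    (hb : b ∈ L G j) : ⁅a, b⁆ ∈ L G (i + j) :=
  commutator_L_le i j hi hj (Subgroup.commutator_mem_commutator ha hb)

/-- Functions that restrict to a homomorphism on `L j` with kernel containing `L (j + 1)`. -/
structure IsGradedHom (j : ℕ) (h : G → ℂ) : Prop where
  map_mul : ∀ a ∈ L G j, ∀ b ∈ L G j, h (a * b) = h a + h b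
  eq_zero : ∀ a ∈ L G (j + 1), h a = 0

namespace IsGradedHom

variable {j : ℕ} {h : G → ℂ}

theorem map_inv (hh : IsGradedHom j h) {a : G} (ha : a ∈ L G j) : h a⁻¹ = -h a := by
  have := hh.map_mul a ha a⁻¹ (Subgroup.inv_mem _ ha)
  rw [mul_inv_cancel, hh.eq_zero 1 (Subgroup.one_mem _)] at this
  linear_combination -this

theorem map_conj (hh : IsGradedHom j h) (hj : 1 ≤ j) {a : G} (ha : a ∈ L G j) (b : G) :
    h (b * a * b⁻¹) = h a := by
  have h1 : ⁅b, a⁆ ∈ L G (j + 1) := by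
    rw [add_comm]
    exact commutator_mem_L le_rfl hj (Subgroup.mem_top b) ha
  have e : b * a * b⁻¹ = ⁅b, a⁆ * a := by rw [commutatorElement_def]; group
  rw [e, hh.map_mul _ (L_antitone (Nat.le_succ j) h1) _ ha, hh.eq_zero _ h1, zero_add]

theorem comm_left {i l : ℕ} (hh : IsGradedHom (i + l) h) (hi : 1 ≤ i) (hl : 1 ≤ l) {c : G}
    (hc : c ∈ L G l) : IsGradedHom i fun y : G => h ⁅y, c⁆ where
  map_mul a ha b hb := by
    have e : ⁅a * b, c⁆ = a * ⁅b, c⁆ * a⁻¹ * ⁅a, c⁆ := by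
      simp only [commutatorElement_def]; group
    have hbc := commutator_mem_L hi hl hb hc
    rw [e, hh.map_mul _ ((L_normal _).conj_mem _ hbc _) _ (commutator_mem_L hi hl ha hc),
      hh.map_conj (by omega) hbc, add_comm]
  eq_zero a ha := hh.eq_zero _ (by
    rw [show i + l + 1 = i + 1 + l by ring]
    exact commutator_mem_L (by omega) hl ha hc)

theorem comm_swap {i l : ℕ} (hh : IsGradedHom (i + l) h) (hi : 1 ≤ i) (hl : 1 ≤ l) {a b : G}
    (ha : a ∈ L G i) (hb : b ∈ L G l) : h ⁅b, a⁆ = -h ⁅a, b⁆ := by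
  rw [← commutatorElement_inv, hh.map_inv (commutator_mem_L hi hl ha hb)]

theorem comm_right {i l : ℕ} (hh : IsGradedHom (i + l) h) (hi : 1 ≤ i) (hl : 1 ≤ l) {a : G}
    (ha : a ∈ L G i) : IsGradedHom l fun c : G => h ⁅a, c⁆ := by
  have h1 := (show i + l = l + i from add_comm _ _) ▸ hh
  have h2 := h1.comm_left hl hi ha
  have key : ∀ c ∈ L G l, h ⁅a, c⁆ = -h ⁅c, a⁆ := fun c hc => h1.comm_swap hl hi hc ha
  constructor
  · intro c hc d hd
    rw [key _ (Subgroup.mul_mem _ hc hd), key c hc, key d hd, h2.map_mul c hc d hd, neg_add]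
  · intro c hc
    rw [key c (L_antitone (Nat.le_succ l) hc), h2.eq_zero c hc, neg_zero]

/-- The Jacobi identity, as a consequence of the Hall-Witt identity. -/
theorem jacobi {i l m : ℕ} (hh : IsGradedHom (i + l + m) h) (hi : 1 ≤ i) (hl : 1 ≤ l)
    (hm : 1 ≤ m) {x y z : G} (hx : x ∈ L G i) (hy : y ∈ L G l) (hz : z ∈ L G m) :
    h ⁅x, ⁅y, z⁆⁆ = h ⁅⁅x, y⁆, z⁆ - h ⁅⁅x, z⁆, y⁆ := by
  -- The Hall-Witt identity.
  have hw : ⁅⁅x, y⁆, y * z * y⁻¹⁆ * ⁅⁅y, z⁆, z * x * z⁻¹⁆ * ⁅⁅z, x⁆, x * y * x⁻¹⁆ = 1 := by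
    simp only [commutatorElement_def]; group
  have h2 : IsGradedHom (l + m + i) h := by convert hh using 1; ring
  have h3 : IsGradedHom (m + i + l) h := by convert hh using 1; ring
  have h4 : IsGradedHom (i + (l + m)) h := by convert hh using 1; ring
  have hxy := commutator_mem_L hi hl hx hy
  have hyz := commutator_mem_L hl hm hy hz
  have hzx := commutator_mem_L hm hi hz hx
  have e1 : h ⁅⁅x, y⁆, y * z * y⁻¹⁆ = h ⁅⁅x, y⁆, z⁆ :=
    (hh.comm_right (by omega) hm hxy).map_conj hm hz y
  have e2 : h ⁅⁅y, z⁆, z * x * z⁻¹⁆ = h ⁅⁅y, z⁆, x⁆ :=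
    (h2.comm_right (by omega) hi hyz).map_conj hi hx z
  have e3 : h ⁅⁅z, x⁆, x * y * x⁻¹⁆ = h ⁅⁅z, x⁆, y⁆ :=
    (h3.comm_right (by omega) hl hzx).map_conj hl hy x
  have m1 : ⁅⁅x, y⁆, y * z * y⁻¹⁆ ∈ L G (i + l + m) :=
    commutator_mem_L (by omega) hm hxy ((L_normal _).conj_mem _ hz _)
  have m2 : ⁅⁅y, z⁆, z * x * z⁻¹⁆ ∈ L G (i + l + m) := by
    rw [show i + l + m = l + m + i by ring]
    exact commutator_mem_L (by omega) hi hyz ((L_normal _).conj_mem _ hx _)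
  have m3 : ⁅⁅z, x⁆, x * y * x⁻¹⁆ ∈ L G (i + l + m) := by
    rw [show i + l + m = m + i + l by ring]
    exact commutator_mem_L (by omega) hl hzx ((L_normal _).conj_mem _ hy _)
  have hsum := congrArg h hw
  rw [hh.map_mul _ (Subgroup.mul_mem _ m1 m2) _ m3, hh.map_mul _ m1 _ m2, e1, e2, e3,
    hh.eq_zero 1 (Subgroup.one_mem _)] at hsum
  have e4 : h ⁅⁅z, x⁆, y⁆ = -h ⁅⁅x, z⁆, y⁆ := by
    rw [← commutatorElement_inv x z]
    refine (IsGradedHom.comm_left (i := i + m) (l := l) ?_ (by omega) hl hy).map_inv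
      (commutator_mem_L hi hm hx hz)
    convert hh using 1; ring
  have e5 : h ⁅x, ⁅y, z⁆⁆ = -h ⁅⁅y, z⁆, x⁆ := h2.comm_swap (by omega) hi hyz hx
  rw [e5]
  linear_combination -hsum + e4

/-- Two graded homomorphisms on `L (j + 1)` that agree on the generating commutators agree. -/
theorem ext_commutator (hj : 1 ≤ j) {h h' : G → ℂ} (hh : IsGradedHom (j + 1) h)
    (hh' : IsGradedHom (j + 1) h') (e : ∀ x ∈ L G j, ∀ v, h ⁅x, v⁆ = h' ⁅x, v⁆) {a : G}
    (ha : a ∈ L G (j + 1)) : h a = h' a := by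
  have hle := L_succ (G := G) hj
  have ha' := ha
  rw [hle, Subgroup.commutator_def] at ha'
  induction ha' using Subgroup.closure_induction with
  | mem x hx => obtain ⟨g, hg, v, -, rfl⟩ := hx; exact e g hg v
  | one => rw [hh.eq_zero _ (Subgroup.one_mem _), hh'.eq_zero _ (Subgroup.one_mem _)]
  | mul x y hx hy ex ey =>
    rw [← Subgroup.commutator_def, ← hle] at hx hy
    rw [hh.map_mul x hx y hy, hh'.map_mul x hx y hy, ex hx, ey hy]
  | inv x hx ex =>
    rw [← Subgroup.commutator_def, ← hle] at hx
    rw [hh.map_inv hx, hh'.map_inv hx, ex hx]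

end IsGradedHom

end Lower

/-! ### Coefficients of iterated brackets, and truncated expansions of a group -/

section Dynkin

variable {G : Type} [Group G] {n : ℕ}

/-- The functions `p_1, …, p_n` form a basis of `Hom(G, ℂ)`. -/
def IsHomBasis (p : Fin n → G → ℂ) : Prop :=
  ∀ φ : G →* Multiplicative ℂ,
    ∃! a : Fin n → ℂ, ∀ σ, Multiplicative.toAdd (φ σ) = ∑ i, a i * p i σ

open Classical in
/-- The coefficients of an additive function with respect to a basis of `Hom(G, ℂ)`. -/
def homCoeff (p : Fin n → G → ℂ) (φ : G → ℂ) : Fin n → ℂ :=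
  if h : ∃ a : Fin n → ℂ, ∀ σ, φ σ = ∑ i, a i * p i σ then h.choose else 0

variable {p : Fin n → G → ℂ}

theorem IsHomBasis.existsUnique (hp : IsHomBasis p) {φ : G → ℂ}
    (hφ : ∀ a b, φ (a * b) = φ a + φ b) :
    ∃! a : Fin n → ℂ, ∀ σ, φ σ = ∑ i, a i * p i σ :=
  hp (MonoidHom.mk' (fun g => Multiplicative.ofAdd (φ g)) fun a b => by rw [hφ, ofAdd_add])

theorem IsHomBasis.eq_sum (hp : IsHomBasis p) {φ : G → ℂ} (hφ : ∀ a b, φ (a * b) = φ a + φ b)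
    (σ : G) : φ σ = ∑ i, homCoeff p φ i * p i σ := by
  have h := (hp.existsUnique hφ).exists
  rw [homCoeff, dif_pos h]
  exact h.choose_spec σ

theorem IsHomBasis.coeff_eq (hp : IsHomBasis p) {φ : G → ℂ} (hφ : ∀ a b, φ (a * b) = φ a + φ b)
    {a : Fin n → ℂ} (ha : ∀ σ, φ σ = ∑ i, a i * p i σ) : homCoeff p φ = a :=
  (hp.existsUnique hφ).unique (hp.eq_sum hφ) ha

theorem IsHomBasis.coeff_zero (hp : IsHomBasis p) : homCoeff p (fun _ => 0) = 0 :=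
  hp.coeff_eq (by simp) (by simp)

theorem IsHomBasis.coeff_add (hp : IsHomBasis p) {φ ψ : G → ℂ}
    (hφ : ∀ a b, φ (a * b) = φ a + φ b) (hψ : ∀ a b, ψ (a * b) = ψ a + ψ b) :
    homCoeff p (fun g => φ g + ψ g) = homCoeff p φ + homCoeff p ψ := by
  refine hp.coeff_eq (fun a b => ?_) fun σ => ?_
  · rw [hφ, hψ]; ring
  · rw [hp.eq_sum hφ, hp.eq_sum hψ, ← Finset.sum_add_distrib]
    exact Finset.sum_congr rfl fun i _ => by rw [Pi.add_apply, add_mul]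

variable (p) in
/-- The coefficients of the multiadditive functions `(v_1, …, v_l) ↦ h [… [[y, v_1], v_2], …, v_l]`
with respect to a basis of `Hom(G, ℂ)`. -/
def bracketCoeff (h : G → ℂ) : List (Fin n) → G → ℂ
  | [], y => h y
  | a :: w, y => homCoeff p (fun v => bracketCoeff h w ⁅y, v⁆) a

variable (p) in
/-- The coefficients of the multiadditive functions `(v_1, …, v_l) ↦ h [… [v_1, v_2], …, v_l]`
with respect to a basis of `Hom(G, ℂ)`. -/
def dynkinCoeff (h : G → ℂ) : List (Fin n) → ℂ
  | [] => 0
  | a :: w => homCoeff p (bracketCoeff p h w) a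

variable {j : ℕ} {h : G → ℂ}

theorem bracketCoeff_eq_zero (hp : IsHomBasis p) (hh : IsGradedHom j h) (w : List (Fin n)) :
    ∀ {i : ℕ} {y : G}, 1 ≤ i → y ∈ L G i → j < i + w.length → bracketCoeff p h w y = 0 := by
  induction w with
  | nil => intro i y _ hy hij; exact hh.eq_zero y (L_antitone (by simpa using hij) hy)
  | cons a w ih =>
    intro i y hi hy hij
    have : (fun v => bracketCoeff p h w ⁅y, v⁆) = fun _ => 0 := by
      funext v
      refine ih (i := i + 1) (by omega) (commutator_mem_L hi le_rfl hy (Subgroup.mem_top v)) ?_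
      simp only [List.length_cons] at hij
      omega
    rw [bracketCoeff, this, hp.coeff_zero, Pi.zero_apply]

theorem IsGradedHom.additive {h : G → ℂ} (hh : IsGradedHom 1 h) (a b : G) :
    h (a * b) = h a + h b :=
  hh.map_mul a (Subgroup.mem_top a) b (Subgroup.mem_top b)

theorem isGradedHom_bracketCoeff (hp : IsHomBasis p) (hh : IsGradedHom j h) (w : List (Fin n)) :
    ∀ {i : ℕ}, 1 ≤ i → i + w.length = j → IsGradedHom i (bracketCoeff p h w) := by
  induction w with
  | nil => intro i _ hij; exact (show i = j by simpa using hij) ▸ hh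
  | cons a w ih =>
    intro i hi hij
    simp only [List.length_cons] at hij
    have hw := ih (i := i + 1) (by omega) (by omega)
    have hadd : ∀ y ∈ L G i, ∀ u v, bracketCoeff p h w ⁅y, u * v⁆ =
        bracketCoeff p h w ⁅y, u⁆ + bracketCoeff p h w ⁅y, v⁆ := fun y hy =>
      (hw.comm_right hi le_rfl hy).additive
    refine ⟨fun y hy z hz => ?_, fun y hy => ?_⟩
    · have e : (fun v => bracketCoeff p h w ⁅y * z, v⁆) =
          fun v => bracketCoeff p h w ⁅y, v⁆ + bracketCoeff p h w ⁅z, v⁆ := funext fun v =>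
        (hw.comm_left hi le_rfl (Subgroup.mem_top v)).map_mul y hy z hz
      simp only [bracketCoeff]
      rw [e, hp.coeff_add (hadd y hy) (hadd z hz), Pi.add_apply]
    · exact bracketCoeff_eq_zero hp hh (a :: w) (i := i + 1) (by omega) hy (by simp; omega)

theorem bracketCoeff_comm (hp : IsHomBasis p) (hh : IsGradedHom j h) {w : List (Fin n)} {i : ℕ}
    (hi : 1 ≤ i) (hij : i + 1 + w.length = j) {y : G} (hy : y ∈ L G i) (v : G) :
    bracketCoeff p h w ⁅y, v⁆ = ∑ a, bracketCoeff p h (a :: w) y * p a v :=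
  hp.eq_sum (φ := fun v => bracketCoeff p h w ⁅y, v⁆)
    ((isGradedHom_bracketCoeff hp hh w (by omega) hij).comm_right hi le_rfl hy).additive v

theorem bracketCoeff_eq_sum_dynkinCoeff (hp : IsHomBasis p) (hh : IsGradedHom j h)
    {w : List (Fin n)} (hij : 1 + w.length = j) (v : G) :
    bracketCoeff p h w v = ∑ a, dynkinCoeff p h (a :: w) * p a v :=
  hp.eq_sum (isGradedHom_bracketCoeff hp hh w le_rfl hij).additive v

theorem dynkinCoeff_eq_zero (hp : IsHomBasis p) (hh : IsGradedHom j h) {w : List (Fin n)}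
    (hw : j < w.length) : dynkinCoeff p h w = 0 := by
  cases w with
  | nil => rfl
  | cons a w =>
    have : bracketCoeff p h w = fun _ => 0 := funext fun v =>
      bracketCoeff_eq_zero hp hh w le_rfl (Subgroup.mem_top v)
        (by simpa [add_comm] using hw)
    rw [dynkinCoeff, this, hp.coeff_zero, Pi.zero_apply]

variable {k : ℕ}

/-- A truncated expansion of the group `G` over the basis `p` of `Hom(G, ℂ)`: an antihomomorphism
to `ℂ_k` of the form `1 + ∑ p_i X_i + ⋯`. -/
structure IsExpansion (p : Fin n → G → ℂ) (Φ : G → Jets n k) : Prop where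
  map_mul : ∀ g h, Φ (g * h) = Φ h * Φ g
  sub_mem : ∀ g, Φ g - 1 - ∑ a, p a g • Jets.X k a ∈ jetFil n k 2

namespace IsExpansion

variable {Φ : G → Jets n k}

theorem sub_one_mem (hΦ : IsExpansion p Φ) (g : G) : Φ g - 1 ∈ jetFil n k 1 := by
  have h := Submodule.add_mem _ (jetFil_antitone (by norm_num) (hΦ.sub_mem g))
    (Submodule.sum_mem (jetFil n k 1) fun a (_ : a ∈ Finset.univ) =>
      Submodule.smul_mem _ (p a g) (X_mem_jetFil a))
  simpa using h

theorem map_one (hΦ : IsExpansion p Φ) : Φ 1 = 1 := by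
  have h1 : Φ 1 * Φ 1 = Φ 1 := by rw [← hΦ.map_mul, one_mul]
  have h2 : IsUnit (Φ 1) := by
    have := IsNilpotent.isUnit_one_add ⟨k + 1, sub_one_pow_eq_zero (hΦ.sub_one_mem 1)⟩
    simpa using this
  exact h2.mul_left_cancel (by rw [h1, mul_one])

theorem mul_inv (hΦ : IsExpansion p Φ) (g : G) : Φ g * Φ g⁻¹ = 1 := by
  rw [← hΦ.map_mul, inv_mul_cancel, hΦ.map_one]

theorem commutator_sub (hΦ : IsExpansion p Φ) (x v : G) :
    Φ ⁅x, v⁆ - 1 =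
      Φ v⁻¹ * Φ x⁻¹ * ((Φ v - 1) * (Φ x - 1) - (Φ x - 1) * (Φ v - 1)) := by
  have h1 : Φ v⁻¹ * Φ x⁻¹ * (Φ x * Φ v) = 1 := by
    rw [← hΦ.map_mul, ← hΦ.map_mul, ← hΦ.map_mul, ← hΦ.map_one]
    congr 1; group
  have h2 : Φ ⁅x, v⁆ = Φ v⁻¹ * Φ x⁻¹ * (Φ v * Φ x) := by
    rw [← hΦ.map_mul, ← hΦ.map_mul, ← hΦ.map_mul, commutatorElement_def, mul_assoc (x * v)]
  calc Φ ⁅x, v⁆ - 1 = Φ v⁻¹ * Φ x⁻¹ * (Φ v * Φ x - Φ x * Φ v) := by rw [mul_sub, h1, h2]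
    _ = _ := by congr 1; noncomm_ring

/-- Elements of `L j` have expansions `1 + ⋯` with terms of degree at least `j`. -/
theorem sub_one_mem_of_mem_L (hΦ : IsExpansion p Φ) {j : ℕ} (hj : 1 ≤ j) {g : G}
    (hg : g ∈ L G j) : Φ g - 1 ∈ jetFil n k j := by
  induction j, hj using Nat.le_induction generalizing g with
  | base => exact hΦ.sub_one_mem g
  | succ j hj ih =>
    rw [L_succ hj, Subgroup.commutator_def] at hg
    induction hg using Subgroup.closure_induction with
    | mem x hx =>
      obtain ⟨y, hy, v, -, rfl⟩ := hx
      rw [hΦ.commutator_sub]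
      refine mul_mem_jetFil_right (Submodule.sub_mem _ ?_ (mul_mem_jetFil (ih hy)
        (hΦ.sub_one_mem v))) _
      exact mul_mem_jetFil_of_eq (add_comm 1 j) (hΦ.sub_one_mem v) (ih hy)
    | one => rw [hΦ.map_one, sub_self]; exact Submodule.zero_mem _
    | mul x y _ _ hx hy =>
      have : Φ (x * y) - 1 = Φ y * (Φ x - 1) + (Φ y - 1) := by rw [hΦ.map_mul]; noncomm_ring
      rw [this]
      exact Submodule.add_mem _ (mul_mem_jetFil_right hx _) hy
    | inv x _ hx =>
      have : Φ x⁻¹ - 1 = -(Φ x⁻¹ * (Φ x - 1)) := by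
        have h := hΦ.mul_inv x⁻¹
        rw [inv_inv] at h
        rw [mul_sub, h]; noncomm_ring
      rw [this]
      exact Submodule.neg_mem _ (mul_mem_jetFil_right hx _)

/-- To lowest order, the expansion of a commutator is the commutator of the expansions. -/
theorem commutator_sub_mem (hΦ : IsExpansion p Φ) {j : ℕ} (hj : 1 ≤ j) {x : G} (hx : x ∈ L G j)
    (v : G) : Φ ⁅x, v⁆ - 1 - ((Φ v - 1) * (Φ x - 1) - (Φ x - 1) * (Φ v - 1)) ∈
      jetFil n k (j + 2) := by
  set c := (Φ v - 1) * (Φ x - 1) - (Φ x - 1) * (Φ v - 1) with hc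
  have hcm : c ∈ jetFil n k (j + 1) := by
    refine Submodule.sub_mem _ ?_ (mul_mem_jetFil (hΦ.sub_one_mem_of_mem_L hj hx)
      (hΦ.sub_one_mem v))
    exact mul_mem_jetFil_of_eq (add_comm 1 j) (hΦ.sub_one_mem v) (hΦ.sub_one_mem_of_mem_L hj hx)
  have : Φ ⁅x, v⁆ - 1 - c = (Φ (v * x)⁻¹ - 1) * c := by
    rw [hΦ.commutator_sub, ← hc, mul_inv_rev, hΦ.map_mul, sub_mul _ 1, one_mul]
  rw [this]
  exact mul_mem_jetFil_of_eq (by ring) (hΦ.sub_one_mem _) hcm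

end IsExpansion

end Dynkin

/-! ### Dynkin's formula for truncated expansions -/

namespace IsExpansion

variable {G : Type} [Group G] {n k : ℕ} {p : Fin n → G → ℂ} {Φ : G → Jets n k}

theorem jetAct_sub_one (hΦ : IsExpansion p Φ) {f : List (Fin n) → ℂ} {w : List (Fin n)}
    (hw : w.length + 1 ≤ k) (hf : ∀ v : List (Fin n), w.length + 2 ≤ v.length → f v = 0) (g : G) :
    jetAct n k (Φ g - 1) f w = ∑ a, f (a :: w) * p a g := by
  have h := jetAct_eq_zero k (by norm_num) (hΦ.sub_mem g) hf
  rw [map_sub, map_sum, LinearMap.sub_apply, Pi.sub_apply, sub_eq_zero] at h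
  rw [h, LinearMap.sum_apply, Finset.sum_apply]
  refine Finset.sum_congr rfl fun a _ => ?_
  rw [map_smul, LinearMap.smul_apply, Pi.smul_apply, jetAct_X, if_pos hw, smul_eq_mul, mul_comm]

theorem isGradedHom_jetAct (hΦ : IsExpansion p Φ) {l : ℕ} (hl : 1 ≤ l) {f : List (Fin n) → ℂ}
    {w : List (Fin n)} (hf : ∀ v : List (Fin n), w.length + l + 1 ≤ v.length → f v = 0) :
    IsGradedHom l fun x : G => jetAct n k (Φ x - 1) f w where
  map_mul a ha b hb := by
    have e : Φ (a * b) - 1 = (Φ b - 1) * (Φ a - 1) + (Φ a - 1) + (Φ b - 1) := by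
      rw [hΦ.map_mul]; noncomm_ring
    have h0 : jetAct n k ((Φ b - 1) * (Φ a - 1)) f w = 0 :=
      jetAct_eq_zero k (by omega) (mul_mem_jetFil (hΦ.sub_one_mem_of_mem_L hl hb)
        (hΦ.sub_one_mem_of_mem_L hl ha)) fun v hv => hf v (by omega)
    rw [e, map_add, map_add, LinearMap.add_apply, LinearMap.add_apply, Pi.add_apply,
      Pi.add_apply, h0, zero_add]
  eq_zero a ha := jetAct_eq_zero k (by omega) (hΦ.sub_one_mem_of_mem_L (by omega) ha) fun v hv =>
    hf v (by omega)

theorem jetAct_commutator (hΦ : IsExpansion p Φ) {l : ℕ} (hl : 1 ≤ l) {x : G} (hx : x ∈ L G l)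
    (v : G) {f : List (Fin n) → ℂ} {w : List (Fin n)}
    (hf : ∀ u : List (Fin n), w.length + l + 2 ≤ u.length → f u = 0) :
    jetAct n k (Φ ⁅x, v⁆ - 1) f w =
      jetAct n k (Φ v - 1) (jetAct n k (Φ x - 1) f) w -
        jetAct n k (Φ x - 1) (jetAct n k (Φ v - 1) f) w := by
  have h := jetAct_eq_zero k (by omega) (hΦ.commutator_sub_mem hl hx v) (f := f) (w := w)
    fun u hu => hf u (by omega)
  rw [map_sub, map_sub (jetAct n k) (_ * _), LinearMap.sub_apply, LinearMap.sub_apply, Pi.sub_apply,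
    Pi.sub_apply, _root_.map_mul, _root_.map_mul, Module.End.mul_apply, Module.End.mul_apply,
    sub_eq_zero] at h
  exact h

variable {j : ℕ} {h : G → ℂ}

/-- The action of the lowest order term of the expansion of `x` on bracket coefficients is the
bracket with `x`. -/
theorem jetAct_bracketCoeff (hΦ : IsExpansion p Φ) (hp : IsHomBasis p) (hh : IsGradedHom j h)
    (hjk : j ≤ k) {l : ℕ} (hl : 1 ≤ l) : ∀ {x : G}, x ∈ L G l → ∀ {i : ℕ}, 1 ≤ i →
      ∀ {y : G}, y ∈ L G i → ∀ {w : List (Fin n)}, i + l + w.length = j →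
      jetAct n k (Φ x - 1) (fun u => bracketCoeff p h u y) w = bracketCoeff p h w ⁅y, x⁆ := by
  induction l, hl using Nat.le_induction with
  | base =>
    intro x _ i hi y hy w hw
    rw [hΦ.jetAct_sub_one (by omega) (fun v hv => bracketCoeff_eq_zero hp hh v hi hy (by omega)),
      bracketCoeff_comm hp hh hi hw hy]
  | succ l hl ih =>
    intro x hx i hi y hy w hw
    have hf : ∀ u : List (Fin n), w.length + l + 2 ≤ u.length → bracketCoeff p h u y = 0 :=
      fun u hu => bracketCoeff_eq_zero hp hh u hi hy (by omega)
    have hβ : IsGradedHom (i + l + 1) (bracketCoeff p h w) :=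
      isGradedHom_bracketCoeff hp hh w (by omega) (by omega)
    refine IsGradedHom.ext_commutator hl
      (hΦ.isGradedHom_jetAct (w := w) (by omega) fun u hu => hf u (by omega))
      (hβ.comm_right (l := l + 1) hi (by omega) hy) (fun x hx v => ?_) hx
    have hyx := commutator_mem_L hi hl hy hx
    have hyv := commutator_mem_L hi le_rfl hy (Subgroup.mem_top v)
    have e1 : jetAct n k (Φ v - 1) (jetAct n k (Φ x - 1) fun u => bracketCoeff p h u y) w =
        bracketCoeff p h w ⁅⁅y, x⁆, v⁆ := by
      rw [hΦ.jetAct_sub_one (by omega) fun u hu => jetAct_eq_zero k hl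
          (hΦ.sub_one_mem_of_mem_L hl hx) fun u' hu' => hf u' (by omega),
        bracketCoeff_comm hp hh (by omega) (by omega) hyx]
      refine Finset.sum_congr rfl fun a _ => ?_
      rw [ih hx hi hy (by rw [List.length_cons]; omega)]
    have e2 : jetAct n k (Φ x - 1) (jetAct n k (Φ v - 1) fun u => bracketCoeff p h u y) w =
        bracketCoeff p h w ⁅⁅y, v⁆, x⁆ := by
      rw [← ih hx (by omega) hyv (by omega)]
      refine jetAct_congr k hl (hΦ.sub_one_mem_of_mem_L hl hx) fun u hu => ?_
      rcases hu.eq_or_lt with hu | hu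
      · rw [hΦ.jetAct_sub_one (by omega) (fun u' hu' => hf u' (by omega)),
          bracketCoeff_comm hp hh hi (by omega) hy]
      · rw [bracketCoeff_eq_zero hp hh u (by omega) hyv (by omega)]
        exact jetAct_eq_zero k le_rfl (hΦ.sub_one_mem v) fun u' hu' => hf u' (by omega)
    rw [hΦ.jetAct_commutator hl hx v hf, e1, e2,
      hβ.jacobi hi hl le_rfl hy hx (Subgroup.mem_top v)]

/-- Dynkin's formula: left-normed bracketing multiplies the lowest order term of the expansion of
`x`, a Lie element of degree `l`, by `l`. -/
theorem jetAct_dynkinCoeff (hΦ : IsExpansion p Φ) (hp : IsHomBasis p) (hh : IsGradedHom j h)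
    (hjk : j ≤ k) {l : ℕ} (hl : 1 ≤ l) : ∀ {x : G}, x ∈ L G l →
      ∀ {w : List (Fin n)}, l + w.length = j →
      jetAct n k (Φ x - 1) (dynkinCoeff p h) w = l * bracketCoeff p h w x := by
  have hf : ∀ {u : List (Fin n)}, j + 1 ≤ u.length → dynkinCoeff p h u = 0 :=
    fun hu => dynkinCoeff_eq_zero hp hh hu
  induction l, hl using Nat.le_induction with
  | base =>
    intro x _ w hw
    rw [hΦ.jetAct_sub_one (by omega) (fun v hv => hf (by omega)),
      bracketCoeff_eq_sum_dynkinCoeff hp hh hw, Nat.cast_one, one_mul]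
  | succ l hl ih =>
    intro x hx w hw
    have hβ : IsGradedHom (l + 1) (bracketCoeff p h w) :=
      isGradedHom_bracketCoeff hp hh w (by omega) hw
    have hβ' : IsGradedHom (l + 1) fun x : G => ((l + 1 : ℕ) : ℂ) * bracketCoeff p h w x :=
      ⟨fun a ha b hb => by rw [hβ.map_mul a ha b hb, mul_add],
        fun a ha => by rw [hβ.eq_zero a ha, mul_zero]⟩
    refine IsGradedHom.ext_commutator hl
      (hΦ.isGradedHom_jetAct (w := w) (by omega) fun u hu => hf (by omega)) hβ'
      (fun x hx v => ?_) hx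
    have e1 : jetAct n k (Φ v - 1) (jetAct n k (Φ x - 1) (dynkinCoeff p h)) w =
        l * bracketCoeff p h w ⁅x, v⁆ := by
      rw [hΦ.jetAct_sub_one (by omega) fun u hu => jetAct_eq_zero k hl
          (hΦ.sub_one_mem_of_mem_L hl hx) fun u' hu' => hf (by omega),
        bracketCoeff_comm hp hh hl hw hx, Finset.mul_sum]
      refine Finset.sum_congr rfl fun a _ => ?_
      rw [ih hx (by rw [List.length_cons]; omega), mul_assoc]
    have e2 : jetAct n k (Φ x - 1) (jetAct n k (Φ v - 1) (dynkinCoeff p h)) w =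
        bracketCoeff p h w ⁅v, x⁆ := by
      rw [← hΦ.jetAct_bracketCoeff hp hh hjk hl hx le_rfl (Subgroup.mem_top v) (by omega)]
      refine jetAct_congr k hl (hΦ.sub_one_mem_of_mem_L hl hx) fun u hu => ?_
      rcases hu.eq_or_lt with hu | hu
      · rw [hΦ.jetAct_sub_one (by omega) (fun u' hu' => hf (by omega)),
          bracketCoeff_eq_sum_dynkinCoeff hp hh (by omega)]
      · rw [bracketCoeff_eq_zero hp hh u le_rfl (Subgroup.mem_top v) (by omega)]
        exact jetAct_eq_zero k le_rfl (hΦ.sub_one_mem v) fun u' hu' => hf (by omega)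
    rw [hΦ.jetAct_commutator hl hx v (fun u hu => hf (by omega)), e1, e2,
      hβ.comm_swap hl le_rfl hx (Subgroup.mem_top v)]
    push_cast
    ring

/-- Every homomorphism `L j / L (j + 1) → ℂ` with `1 ≤ j ≤ k` is the restriction of a linear
functional of the logarithm of the expansion. -/
theorem exists_functional (hΦ : IsExpansion p Φ) (hp : IsHomBasis p) (hh : IsGradedHom j h)
    (hj : 1 ≤ j) (hjk : j ≤ k) :
    ∃ l : Jets n k →ₗ[ℂ] ℂ, ∀ g ∈ L G j, l (truncLog k (Φ g)) = h g := by
  let l : Jets n k →ₗ[ℂ] ℂ :=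
    (j : ℂ)⁻¹ • ((LinearMap.proj ([] : List (Fin n))).comp
      ((LinearMap.applyₗ (dynkinCoeff p h)).comp (jetAct n k).toLinearMap))
  have hl : ∀ x, l x = (j : ℂ)⁻¹ * jetAct n k x (dynkinCoeff p h) [] := fun x => rfl
  refine ⟨l, fun g hg => ?_⟩
  have h1 := hΦ.sub_one_mem_of_mem_L hj hg
  have h2 := jetAct_eq_zero k (by omega) (truncLog_sub_mem (hj.trans hjk) hj h1) (w := [])
    (fun v hv => dynkinCoeff_eq_zero hp hh (by simpa using hv))
  rw [map_sub, LinearMap.sub_apply, Pi.sub_apply, sub_eq_zero] at h2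
  rw [hl, h2, hΦ.jetAct_dynkinCoeff hp hh hjk hj hg (by simp), bracketCoeff,
    inv_mul_cancel_left₀ (by exact_mod_cast (by omega : j ≠ 0))]

end IsExpansion

/-! ### The orbit depth and the quotient of spans of logarithms -/

/-- Extension of homomorphisms with values in the divisible group `ℂ`. -/
theorem exists_addHom_extension {A B : Type} [AddCommGroup A] [AddCommGroup B] (q : A →+ B)
    (g : A →+ ℂ) (h : ∀ a, q a = 0 → g a = 0) : ∃ g' : B →+ ℂ, ∀ a, g' (q a) = g a := by
  have hdiv : DivisibleBy ℂ ℤ := AddCommGroup.divisibleByIntOfSMulTopEqTop ℂ fun {n} hn => by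
    refine eq_top_iff.2 fun x _ => ?_
    have hn' : (n : ℂ) ≠ 0 := by exact_mod_cast hn
    exact ⟨x / n, trivial, by simp [mul_div_cancel₀ _ hn']⟩
  obtain ⟨g', hg'⟩ := Module.Baer.extension_property_addMonoidHom (Module.Baer.of_divisible ℂ)
    (QuotientAddGroup.kerLift q) (QuotientAddGroup.kerLift_injective q)
    (QuotientAddGroup.lift q.ker g fun a ha => h a ha)
  exact ⟨g', fun a => DFunLike.congr_fun hg' (a : A ⧸ q.ker)⟩

section Group

variable {G : Type} [Group G]

/-- A homomorphism on a subgroup of `L j` that vanishes on `L (j + 1)` extends to a homomorphism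
on `L j` that vanishes on `L (j + 1)`. -/
theorem exists_isGradedHom_extension {j : ℕ} (hj : 1 ≤ j) (H : Subgroup G) (hH : H ≤ L G j)
    (f : G → ℂ) (hf : ∀ a ∈ H, ∀ b ∈ H, f (a * b) = f a + f b)
    (hf' : ∀ a ∈ H, a ∈ L G (j + 1) → f a = 0) :
    ∃ h : G → ℂ, IsGradedHom j h ∧ ∀ a ∈ H, h a = f a := by
  have hK : K (L G j) = L G (j + 1) := (L_succ hj).symm
  let q₀ : H →* H1 (L G j) := (QuotientGroup.mk' _).comp (Subgroup.inclusion hH)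
  let g₀ : H →* Multiplicative ℂ :=
    MonoidHom.mk' (fun a => Multiplicative.ofAdd (f a)) fun a b => by
      rw [← ofAdd_add, ← hf a a.2 b b.2]; rfl
  obtain ⟨g', hg'⟩ := exists_addHom_extension (MonoidHom.toAdditive (Abelianization.lift q₀))
    (MonoidHom.toAdditiveLeft (Abelianization.lift g₀)) (fun a ha => by
      obtain ⟨b, hb⟩ := QuotientGroup.mk_surjective (s := commutator H) a.toMul
      have e : a = Additive.ofMul (Abelianization.of b) := by
        rw [← ofMul_toMul a, ← hb]; rfl
      subst e
      have h1 : q₀ b = 1 := ha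
      change f b = 0
      refine hf' b b.2 ?_
      rw [← hK]
      exact Subgroup.mem_subgroupOf.1
        ((QuotientGroup.eq_one_iff (Subgroup.inclusion hH b)).1 h1))
  classical
  refine ⟨fun a => if ha : a ∈ L G j then
    g' (Additive.ofMul (QuotientGroup.mk ⟨a, ha⟩ : H1 (L G j))) else 0, ⟨?_, ?_⟩, ?_⟩
  · intro a ha b hb
    rw [dif_pos ha, dif_pos hb, dif_pos (Subgroup.mul_mem _ ha hb), ← map_add]
    rfl
  · intro a ha
    rw [dif_pos (L_antitone (Nat.le_succ j) ha)]
    have : (QuotientGroup.mk ⟨a, L_antitone (Nat.le_succ j) ha⟩ : H1 (L G j)) = 1 := by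
      rw [QuotientGroup.eq_one_iff, Subgroup.mem_subgroupOf, hK]
      exact ha
    rw [this, ofMul_one, map_zero]
  · intro a ha
    refine (dif_pos (hH ha)).trans ?_
    exact hg' (Additive.ofMul (Abelianization.of ⟨a, ha⟩))

theorem CH1.of_mul (O : Subgroup G) [O.Normal] (a b : O) :
    CH1.of O (a * b) = CH1.of O a + CH1.of O b := by
  rw [CH1.of, QuotientGroup.mk_mul, ofMul_mul, TensorProduct.tmul_add]
  rfl

theorem CH1.of_eq_zero (O : Subgroup G) [O.Normal] (a : O) (ha : (a : G) ∈ K O) :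
    CH1.of O a = 0 := by
  have : (QuotientGroup.mk a : H1 O) = 1 := by
    rw [QuotientGroup.eq_one_iff, Subgroup.mem_subgroupOf]
    exact ha
  rw [CH1.of, this, ofMul_one, TensorProduct.tmul_zero]

/-- Linear maps on `ℂH₁(O)` are determined by their values on classes of elements of `O`. -/
theorem CH1.hom_ext (O : Subgroup G) [O.Normal] {W : Type*} [AddCommGroup W] [Module ℂ W]
    {f g : CH1 O →ₗ[ℂ] W} (h : ∀ σ : O, f (CH1.of O σ) = g (CH1.of O σ)) : f = g := by
  refine LinearMap.ext fun x => ?_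
  induction x using TensorProduct.induction_on with
  | zero => rw [map_zero, map_zero]
  | tmul c a =>
    obtain ⟨b, hb⟩ := QuotientGroup.mk_surjective a.toMul
    have e : c ⊗ₜ[ℤ] a = c • CH1.of O b := by
      rw [CH1.of, TensorProduct.smul_tmul', smul_eq_mul, mul_one, hb, ofMul_toMul]
    rw [e, map_smul, map_smul, h]
  | add x y hx hy => rw [map_add, map_add, hx, hy]

/-- The linear map on `ℂH₁(O)` induced by a homomorphism on `O` that vanishes on `K`. -/
theorem CH1.exists_lift (O : Subgroup G) [O.Normal] {W : Type*} [AddCommGroup W] [Module ℂ W]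
    (f : O → W) (hf : ∀ a b, f (a * b) = f a + f b) (hK : ∀ a : O, (a : G) ∈ K O → f a = 0) :
    ∃ l : CH1 O →ₗ[ℂ] W, ∀ σ, l (CH1.of O σ) = f σ := by
  let f₀ : O →* Multiplicative W :=
    MonoidHom.mk' (fun a => Multiplicative.ofAdd (f a)) fun a b => by rw [hf, ofAdd_add]
  let f₁ : Additive (H1 O) →+ W := MonoidHom.toAdditiveLeft
    (QuotientGroup.lift ((K O).subgroupOf O) f₀ fun a ha => by
      change Multiplicative.ofAdd (f a) = 1
      rw [hK a ha, ofAdd_zero])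
  refine ⟨f₁.toIntLinearMap.liftBaseChange ℂ, fun σ => ?_⟩
  rw [CH1.of, LinearMap.liftBaseChange_tmul, one_smul]
  rfl

theorem torsionFreeDepth_eq {O : Subgroup G} [O.Normal] {k : ℕ}
    (hk : torsionFreeDepth O = (k : ℕ∞)) : 1 ≤ k ∧ layer O (k + 1) = ⊥ := by
  set S : Set ℕ := {j : ℕ | 1 ≤ j ∧ layer O (j + 1) = ⊥} with hS
  have hne : S.Nonempty := by
    by_contra h
    rw [Set.not_nonempty_iff_eq_empty] at h
    rw [torsionFreeDepth, ← hS, h] at hk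
    simp at hk
  have hmem := Nat.sInf_mem hne
  have h2 : torsionFreeDepth O = ((sInf S : ℕ) : ℕ∞) :=
    le_antisymm (iInf₂_le _ hmem) (le_iInf₂ fun j hj => by exact_mod_cast Nat.sInf_le hj)
  have : k = sInf S := by exact_mod_cast hk.symm.trans h2
  rw [this]
  exact hmem

end Group

namespace IsExpansion

variable {G : Type} [Group G] {n k : ℕ} {p : Fin n → G → ℂ} {Φ : G → Jets n k}

theorem eq_one_of_mem_L (hΦ : IsExpansion p Φ) {g : G} (hg : g ∈ L G (k + 1)) : Φ g = 1 :=
  sub_eq_zero.1 (eq_zero_of_mem_jetFil k.lt_succ_self (hΦ.sub_one_mem_of_mem_L (by omega) hg))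

theorem exists_log_quotient (hΦ : IsExpansion p Φ) :
    ∃ Λ : G ⧸ L G (k + 1) → Jets n k, ∀ σ : G, Λ (QuotientGroup.mk σ) = Jets.log (Φ σ) := by
  refine ⟨Quotient.lift (fun σ => Jets.log (Φ σ)) fun a b hab => ?_, fun σ => rfl⟩
  have h : a⁻¹ * b ∈ L G (k + 1) := QuotientGroup.leftRel_apply.1 hab
  have : Φ b = Φ a := by
    rw [← mul_inv_cancel_left a b, hΦ.map_mul, hΦ.eq_one_of_mem_L h, one_mul]
  rw [this]

/-- On a subgroup, the logarithm of the expansion is additive modulo the logarithms of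
commutators. -/
theorem map_log_mul (hΦ : IsExpansion p Φ) (hk : 1 ≤ k) (H : Subgroup G) {W : Type*}
    [AddCommGroup W] [Module ℂ W] (l : Jets n k →ₗ[ℂ] W)
    (hl : ∀ g ∈ ⁅H, H⁆, l (Jets.log (Φ g)) = 0) {x y : G} (hx : x ∈ H) (hy : y ∈ H) :
    l (Jets.log (Φ (x * y))) = l (Jets.log (Φ x)) + l (Jets.log (Φ y)) := by
  refine map_truncLog_mul hk (fun g : H => Φ g) (fun g h => hΦ.map_mul g h)
    (fun g => sub_one_pow_eq_zero (hΦ.sub_one_mem g)) (fun g hg => hΦ.eq_one_of_mem_L ?_) l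
    (fun g hg => hl g ?_) ⟨x, hx⟩ ⟨y, hy⟩
  · have h1 := Subgroup.mem_map_of_mem H.subtype hg
    rw [Subgroup.top_subtype_lowerCentralSeries] at h1
    exact Subgroup.lowerCentralSeries_mono k le_top h1
  · have h1 := Subgroup.mem_map_of_mem H.subtype hg
    rwa [Subgroup.map_subtype_commutator] at h1

/-- Homomorphisms `O / K → ℂ` that vanish on `O ∩ L (k + 1)` are induced by linear functionals of
the logarithm of the expansion: correct the functional successively on `O ∩ L j`, for
`j = k, …, 1`. -/
theorem exists_functional_of_orbit (hΦ : IsExpansion p Φ) (hp : IsHomBasis p) (hk : 1 ≤ k)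
    (O : Subgroup G) [O.Normal] (f : G → ℂ) (hf : ∀ a ∈ O, ∀ b ∈ O, f (a * b) = f a + f b)
    (hK : ∀ a ∈ K O, f a = 0) (hL : ∀ a ∈ O, a ∈ L G (k + 1) → f a = 0) :
    ∃ l : Jets n k →ₗ[ℂ] ℂ, ∀ σ ∈ O, l (Jets.log (Φ σ)) = f σ := by
  suffices h : ∀ d j, j + d = k + 1 → 1 ≤ j →
      ∃ l : Jets n k →ₗ[ℂ] ℂ, ∀ σ ∈ O, σ ∈ L G j → l (Jets.log (Φ σ)) = f σ by
    obtain ⟨l, hl⟩ := h k 1 (by omega) le_rfl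
    exact ⟨l, fun σ hσ => hl σ hσ (Subgroup.mem_top σ)⟩
  intro d
  induction d with
  | zero =>
    intro j hj _
    obtain rfl : j = k + 1 := by omega
    exact ⟨0, fun σ hσ hσL => by rw [hL σ hσ hσL, LinearMap.zero_apply]⟩
  | succ d ih =>
    intro j hj h1
    obtain ⟨l, hl⟩ := ih (j + 1) (by omega) (by omega)
    -- The error `f - l ∘ log ∘ Φ` is additive on `O ∩ L j`, because `l ∘ log ∘ Φ` vanishes on the
    -- commutators of `O ∩ L j`, which lie both in `K` and in `L (j + 1)`.
    have hcomm : ∀ g ∈ ⁅O ⊓ L G j, O ⊓ L G j⁆, l (Jets.log (Φ g)) = 0 := by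
      intro g hg
      have hgK : g ∈ K O := Subgroup.commutator_mono inf_le_left le_top hg
      have hgL : g ∈ L G (j + 1) := by
        rw [L_succ h1]
        exact Subgroup.commutator_mono inf_le_right le_top hg
      rw [hl g (K_le O hgK) hgL, hK g hgK]
    obtain ⟨h, hh, hhf⟩ := exists_isGradedHom_extension h1 (O ⊓ L G j) inf_le_right
      (fun σ => f σ - l (Jets.log (Φ σ)))
      (fun a ha b hb => by
        rw [hf a ha.1 b hb.1, hΦ.map_log_mul hk _ l hcomm ha hb]; ring)
      (fun a ha haL => by rw [hl a ha.1 haL, sub_self])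
    obtain ⟨l', hl'⟩ := hΦ.exists_functional hp hh h1 (by omega)
    refine ⟨l + l', fun σ hσ hσL => ?_⟩
    have e : l' (Jets.log (Φ σ)) = h σ := hl' σ hσL
    rw [LinearMap.add_apply, e, hhf σ ⟨hσ, hσL⟩]
    ring

/-- The isomorphism from `ℂH₁(O)` onto the quotient of the span of the logarithms on `O` by the
span of the logarithms on `K`, when `O ∩ L (k + 1)` is torsion modulo `K`. -/
theorem exists_equiv (hΦ : IsExpansion p Φ) (hp : IsHomBasis p) (O : Subgroup G) [O.Normal]
    (hk : torsionFreeDepth O = (k : ℕ∞)) {N₁ N₀ : Submodule ℂ (Jets n k)}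
    (hN₁ : N₁ = Submodule.span ℂ ((fun σ => Jets.log (Φ σ)) '' (O : Set G)))
    (hN₀ : N₀ = Submodule.span ℂ ((fun σ => Jets.log (Φ σ)) '' (K O : Set G)))
    (c : O → N₁) (hc : ∀ σ, (c σ : Jets n k) = Jets.log (Φ σ)) :
    ∃ e : CH1 O ≃ₗ[ℂ] N₁ ⧸ N₀.submoduleOf N₁,
      ∀ σ : O, e (CH1.of O σ) = Submodule.Quotient.mk (c σ) := by
  obtain ⟨hk1, hlayer⟩ := torsionFreeDepth_eq hk
  have hlogK : ∀ g ∈ K O, Jets.log (Φ g) ∈ N₀ := fun g hg => by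
    rw [hN₀]; exact Submodule.subset_span ⟨g, hg, rfl⟩
  have hmem : ∀ y : N₁, y ∈ N₀.submoduleOf N₁ ↔ (y : Jets n k) ∈ N₀ := fun _ => Iff.rfl
  obtain ⟨l, hl⟩ := CH1.exists_lift O
    (fun σ => (Submodule.Quotient.mk (c σ) : N₁ ⧸ N₀.submoduleOf N₁))
    (fun a b => by
      rw [← Submodule.Quotient.mk_add, Submodule.Quotient.eq, hmem]
      rw [AddSubgroupClass.coe_sub, Submodule.coe_add, hc, hc, hc, ← Submodule.Quotient.eq,
        Submodule.Quotient.mk_add]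
      refine hΦ.map_log_mul hk1 O N₀.mkQ (fun g hg => ?_) a.2 b.2
      rw [Submodule.mkQ_apply, Submodule.Quotient.mk_eq_zero]
      exact hlogK g (Subgroup.commutator_mono le_rfl le_top hg))
    (fun a ha => by
      rw [Submodule.Quotient.mk_eq_zero, hmem, hc]
      exact hlogK a ha)
  refine ⟨LinearEquiv.ofBijective l ⟨?_, ?_⟩, hl⟩
  -- Injectivity: every functional `φ` on `ℂH₁(O)` factors through `l`, because it is induced by a
  -- functional `m` of the logarithm.
  · rw [← LinearMap.ker_eq_bot, LinearMap.ker_eq_bot']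
    intro x hx
    rw [← Module.forall_dual_apply_eq_zero_iff ℂ]
    intro φ
    classical
    let f : G → ℂ := fun g => if hg : g ∈ O then φ (CH1.of O ⟨g, hg⟩) else 0
    have hfO : ∀ σ : O, f σ = φ (CH1.of O σ) := fun σ => dif_pos σ.2
    obtain ⟨m, hm⟩ := hΦ.exists_functional_of_orbit hp hk1 O f
      (fun a ha b hb => by
        have := hfO (⟨a, ha⟩ * ⟨b, hb⟩)
        rw [CH1.of_mul, map_add, ← hfO, ← hfO] at this
        exact this)
      (fun a ha => by
        rw [hfO ⟨a, K_le O ha⟩, CH1.of_eq_zero O ⟨a, K_le O ha⟩ ha, map_zero])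
      (fun a ha haL => by
        have h0 : CH1.of O ⟨a, ha⟩ ∈ layer O (k + 1) := Submodule.subset_span ⟨⟨a, ha⟩, haL, rfl⟩
        rw [hlayer, Submodule.mem_bot] at h0
        rw [hfO ⟨a, ha⟩, h0, map_zero])
    have hker : N₀.submoduleOf N₁ ≤ LinearMap.ker (m.comp N₁.subtype) := by
      intro y hy
      rw [hmem] at hy
      rw [LinearMap.mem_ker, LinearMap.comp_apply, Submodule.subtype_apply]
      have h0 : N₀ ≤ LinearMap.ker m := by
        rw [hN₀, Submodule.span_le]
        rintro _ ⟨g, hg, rfl⟩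
        have hg' := K_le O hg
        change m (Jets.log (Φ g)) = 0
        rw [hm g hg', hfO ⟨g, hg'⟩, CH1.of_eq_zero O ⟨g, hg'⟩ hg, map_zero]
      exact h0 hy
    have hφ : φ = ((N₀.submoduleOf N₁).liftQ (m.comp N₁.subtype) hker).comp l := by
      refine CH1.hom_ext O fun σ => ?_
      rw [LinearMap.comp_apply, hl, Submodule.liftQ_apply, LinearMap.comp_apply,
        Submodule.subtype_apply, hc, hm σ σ.2, hfO]
    rw [hφ, LinearMap.comp_apply, hx, map_zero]
  · intro y
    obtain ⟨⟨z, hz⟩, rfl⟩ := Submodule.Quotient.mk_surjective _ y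
    have hz' := hz
    rw [hN₁] at hz'
    induction hz' using Submodule.span_induction with
    | mem x hx =>
      obtain ⟨σ, hσ, rfl⟩ := hx
      refine ⟨CH1.of O ⟨σ, hσ⟩, ?_⟩
      rw [hl]
      congr 1
      exact Subtype.ext (hc ⟨σ, hσ⟩)
    | zero => exact ⟨0, by rw [map_zero]; rfl⟩
    | add x y hx hy ex ey =>
      rw [← hN₁] at hx hy
      obtain ⟨a, ha⟩ := ex hx
      obtain ⟨b, hb⟩ := ey hy
      exact ⟨a + b, by rw [map_add, ha, hb]; rfl⟩
    | smul t x hx ex =>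
      rw [← hN₁] at hx
      obtain ⟨a, ha⟩ := ex hx
      exact ⟨t • a, by rw [map_smul, ha]; rfl⟩

end IsExpansion

/-! ### Differentiation of functions with values in an algebra -/

section AlgDeriv

open Filter Topology

variable {𝕜 : Type} [NontriviallyNormedField 𝕜] [NormedAlgebra 𝕜 ℂ] {A : Type} [Ring A]
  [Algebra ℂ A]

/-- The function `f` with values in a complex algebra without topology is, near `x`, a finite
combination of fixed vectors with scalar coefficients that are differentiable at `x`, and `f'` is
the corresponding combination of their derivatives. -/
def HasAlgDeriv (f : 𝕜 → A) (f' : A) (x : 𝕜) : Prop :=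
  ∃ (ι : Type) (_ : Fintype ι) (u : ι → 𝕜 → ℂ) (u' : ι → ℂ) (e : ι → A),
    (∀ᶠ t in 𝓝 x, f t = ∑ i, u i t • e i) ∧ f' = ∑ i, u' i • e i ∧
      ∀ i, HasDerivAt (u i) (u' i) x

namespace HasAlgDeriv

variable {f g : 𝕜 → A} {f' g' : A} {x : 𝕜}

theorem smul_const {u : 𝕜 → ℂ} {u' : ℂ} (hu : HasDerivAt u u' x) (e : A) :
    HasAlgDeriv (fun t => u t • e) (u' • e) x :=
  ⟨Unit, inferInstance, fun _ => u, fun _ => u', fun _ => e, by simp, by simp, fun _ => hu⟩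

variable (x) in
theorem const (e : A) : HasAlgDeriv (fun _ : 𝕜 => e) 0 x := by
  simpa using smul_const (hasDerivAt_const x (1 : ℂ)) e

theorem congr (hf : HasAlgDeriv f f' x) (h : g =ᶠ[𝓝 x] f) : HasAlgDeriv g f' x := by
  obtain ⟨ι, _, u, u', e, h1, h2, h3⟩ := hf
  exact ⟨ι, _, u, u', e, by filter_upwards [h, h1] with t ht h't; rw [ht, h't], h2, h3⟩

theorem add (hf : HasAlgDeriv f f' x) (hg : HasAlgDeriv g g' x) :
    HasAlgDeriv (fun t => f t + g t) (f' + g') x := by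
  obtain ⟨ι, _, u, u', e, h1, rfl, h3⟩ := hf
  obtain ⟨κ, _, v, v', d, k1, rfl, k3⟩ := hg
  refine ⟨ι ⊕ κ, inferInstance, Sum.elim u v, Sum.elim u' v', Sum.elim e d, ?_, ?_, ?_⟩
  · filter_upwards [h1, k1] with t h k
    rw [h, k, Fintype.sum_sum_type]
    rfl
  · rw [Fintype.sum_sum_type]
    rfl
  · rintro (i | i)
    exacts [h3 i, k3 i]

theorem mul (hf : HasAlgDeriv f f' x) (hg : HasAlgDeriv g g' x) :
    HasAlgDeriv (fun t => f t * g t) (f' * g x + f x * g') x := by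
  obtain ⟨ι, _, u, u', e, h1, rfl, h3⟩ := hf
  obtain ⟨κ, _, v, v', d, k1, rfl, k3⟩ := hg
  refine ⟨ι × κ, inferInstance, fun i t => u i.1 t * v i.2 t,
    fun i => u' i.1 * v i.2 x + u i.1 x * v' i.2, fun i => e i.1 * d i.2, ?_, ?_, ?_⟩
  · filter_upwards [h1, k1] with t h k
    rw [h, k, Finset.sum_mul_sum, Fintype.sum_prod_type]
    simp only [smul_mul_smul_comm]
  · rw [h1.self_of_nhds, k1.self_of_nhds, Finset.sum_mul_sum, Finset.sum_mul_sum,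
      Fintype.sum_prod_type, ← Finset.sum_add_distrib]
    refine Finset.sum_congr rfl fun i _ => ?_
    rw [← Finset.sum_add_distrib]
    simp only [smul_mul_smul_comm, add_smul]
  · exact fun i => (h3 i.1).mul (k3 i.2)

theorem sum {ι : Type*} (s : Finset ι) {f : ι → 𝕜 → A} {f' : ι → A}
    (h : ∀ i ∈ s, HasAlgDeriv (f i) (f' i) x) :
    HasAlgDeriv (fun t => ∑ i ∈ s, f i t) (∑ i ∈ s, f' i) x := by
  classical
  induction s using Finset.induction_on with
  | empty => simpa using const x (0 : A)
  | insert i s hi ih =>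
    simp only [Finset.sum_insert hi]
    exact (h i (Finset.mem_insert_self i s)).add
      (ih fun j hj => h j (Finset.mem_insert_of_mem hj))

theorem exists_pow (hf : HasAlgDeriv f f' x) (m : ℕ) :
    ∃ g', HasAlgDeriv (fun t => f t ^ m) g' x := by
  induction m with
  | zero => exact ⟨0, by simpa using const x (1 : A)⟩
  | succ m ih =>
    obtain ⟨g', hg⟩ := ih
    exact ⟨_, by simpa only [pow_succ] using hg.mul hf⟩

theorem map (hf : HasAlgDeriv f f' x) (l : A →ₗ[ℂ] ℂ) :
    HasDerivAt (fun t => l (f t)) (l f') x := by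
  obtain ⟨ι, _, u, u', e, h1, rfl, h3⟩ := hf
  have h : HasDerivAt (fun t => ∑ i, u i t * l (e i)) (∑ i, u' i * l (e i)) x :=
    HasDerivAt.fun_sum fun i _ => (h3 i).mul_const _
  rw [map_sum]
  simp only [map_smul, smul_eq_mul]
  refine h.congr_of_eventuallyEq ?_
  filter_upwards [h1] with t ht
  rw [ht, map_sum]
  simp only [map_smul, smul_eq_mul]

theorem unique (hf : HasAlgDeriv f f' x) (hf' : HasAlgDeriv f g' x) : f' = g' := by
  rw [← sub_eq_zero, ← Module.forall_dual_apply_eq_zero_iff ℂ]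
  intro l
  rw [map_sub, (hf.map l).unique (hf'.map l), sub_self]

theorem comp {f : ℂ → A} {u : 𝕜 → ℂ} {u' : ℂ} (hf : HasAlgDeriv f f' (u x))
    (hu : HasDerivAt u u' x) : HasAlgDeriv (fun t => f (u t)) (u' • f') x := by
  obtain ⟨ι, _, v, v', e, h1, rfl, h3⟩ := hf
  refine ⟨ι, inferInstance, fun i t => v i (u t), fun i => v' i * u', e,
    hu.continuousAt.eventually h1, ?_, fun i => (h3 i).comp x hu⟩
  rw [Finset.smul_sum]
  exact Finset.sum_congr rfl fun i _ => by rw [smul_smul, mul_comm]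

/-- The inverse of a unipotent solution of `f' = f * ω` solves `g' = -ω * g`. -/
theorem exists_inverse {f : 𝕜 → A} {ω : A} {k : ℕ} (hf : HasAlgDeriv f (f x * ω) x)
    (hnil : ∀ t, (1 - f t) ^ (k + 1) = 0) :
    HasAlgDeriv (fun t => ∑ j ∈ Finset.range (k + 1), (1 - f t) ^ j)
      (-(ω * ∑ j ∈ Finset.range (k + 1), (1 - f x) ^ j)) x := by
  set g : 𝕜 → A := fun t => ∑ j ∈ Finset.range (k + 1), (1 - f t) ^ j with hg
  have hfg : ∀ t, f t * g t = 1 := fun t => by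
    have := mul_neg_geom_sum (1 - f t) (k + 1)
    rwa [hnil, sub_zero, sub_sub_cancel] at this
  have hgf : ∀ t, g t * f t = 1 := fun t => by
    have := geom_sum_mul_neg (1 - f t) (k + 1)
    rwa [hnil, sub_zero, sub_sub_cancel] at this
  obtain ⟨g', hg'⟩ : ∃ g', HasAlgDeriv g g' x := by
    have h1 := (const x (1 : A)).add ((const x (-1 : A)).mul hf)
    simp only [neg_mul, one_mul, ← sub_eq_add_neg] at h1
    choose g' hg' using h1.exists_pow
    exact ⟨_, sum _ fun j _ => hg' j⟩
  have h0 : f x * ω * g x + f x * g' = 0 := by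
    refine (hf.mul hg').unique ?_
    simp only [hfg]
    exact const x 1
  have : g' = -(ω * g x) := by
    have h2 := congrArg (g x * ·) h0
    simp only [mul_add, ← mul_assoc, hgf, one_mul, mul_zero] at h2
    rw [eq_neg_iff_add_eq_zero, add_comm]
    exact h2
  rwa [this] at hg'

end HasAlgDeriv

/-- The function `f` with values in a complex algebra without topology is a finite combination of
fixed vectors with scalar coefficients that are continuous on `s`. -/
def HasContCoeff {X : Type} [TopologicalSpace X] (f : X → A) (s : Set X) : Prop :=
  ∃ (ι : Type) (_ : Fintype ι) (u : ι → X → ℂ) (e : ι → A),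
    (∀ t, f t = ∑ i, u i t • e i) ∧ ∀ i, ContinuousOn (u i) s

namespace HasContCoeff

variable {X : Type} [TopologicalSpace X] {f g : X → A} {s : Set X}

theorem smul_const {u : X → ℂ} (hu : ContinuousOn u s) (e : A) :
    HasContCoeff (fun t => u t • e) s :=
  ⟨Unit, inferInstance, fun _ => u, fun _ => e, by simp, fun _ => hu⟩

variable (s) in
theorem const (e : A) : HasContCoeff (fun _ => e) s := by
  simpa using smul_const (s := s) continuousOn_const (u := fun _ => (1 : ℂ)) e

theorem add (hf : HasContCoeff f s) (hg : HasContCoeff g s) :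
    HasContCoeff (fun t => f t + g t) s := by
  obtain ⟨ι, _, u, e, h1, h3⟩ := hf
  obtain ⟨κ, _, v, d, k1, k3⟩ := hg
  refine ⟨ι ⊕ κ, inferInstance, Sum.elim u v, Sum.elim e d, fun t => ?_, ?_⟩
  · dsimp only
    rw [h1, k1, Fintype.sum_sum_type]
    rfl
  · rintro (i | i)
    exacts [h3 i, k3 i]

theorem mul (hf : HasContCoeff f s) (hg : HasContCoeff g s) :
    HasContCoeff (fun t => f t * g t) s := by
  obtain ⟨ι, _, u, e, h1, h3⟩ := hf
  obtain ⟨κ, _, v, d, k1, k3⟩ := hg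
  refine ⟨ι × κ, inferInstance, fun i t => u i.1 t * v i.2 t, fun i => e i.1 * d i.2,
    fun t => ?_, fun i => (h3 i.1).mul (k3 i.2)⟩
  dsimp only
  rw [h1, k1, Finset.sum_mul_sum, Fintype.sum_prod_type]
  simp only [smul_mul_smul_comm]

theorem pow (hf : HasContCoeff f s) (m : ℕ) : HasContCoeff (fun t => f t ^ m) s := by
  induction m with
  | zero => simpa using const s (1 : A)
  | succ m ih => simpa only [pow_succ] using ih.mul hf

theorem sum {ι : Type*} (r : Finset ι) {f : ι → X → A} (h : ∀ i ∈ r, HasContCoeff (f i) s) :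
    HasContCoeff (fun t => ∑ i ∈ r, f i t) s := by
  classical
  induction r using Finset.induction_on with
  | empty => simpa using const s (0 : A)
  | insert i r hi ih =>
    simp only [Finset.sum_insert hi]
    exact (h i (Finset.mem_insert_self i r)).add
      (ih fun j hj => h j (Finset.mem_insert_of_mem hj))

theorem map (hf : HasContCoeff f s) (l : A →ₗ[ℂ] ℂ) : ContinuousOn (fun t => l (f t)) s := by
  obtain ⟨ι, _, u, e, h1, h3⟩ := hf
  simp only [h1, map_sum, map_smul, smul_eq_mul]
  exact continuousOn_finsetSum _ fun i _ => (h3 i).mul continuousOn_const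

end HasContCoeff

/-- A function on a convex open set with vanishing derivative is constant. -/
theorem eq_of_hasAlgDeriv_zero {s : Set ℂ} (hs : IsOpen s) (hc : Convex ℝ s) {f : ℂ → A}
    (h : ∀ z ∈ s, HasAlgDeriv f 0 z) {z w : ℂ} (hz : z ∈ s) (hw : w ∈ s) : f z = f w := by
  rw [← sub_eq_zero, ← Module.forall_dual_apply_eq_zero_iff ℂ]
  intro l
  have h1 : ∀ z ∈ s, HasDerivAt (fun t => l (f t)) 0 z := fun z hz => by
    simpa using (h z hz).map l
  rw [map_sub, sub_eq_zero]
  refine hc.is_const_of_fderivWithin_eq_zero (𝕜 := ℂ)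
    (fun z hz => (h1 z hz).differentiableAt.differentiableWithinAt) (fun z hz => ?_) hz hw
  rw [fderivWithin_of_isOpen hs hz]
  exact (h1 z hz).hasFDerivAt.fderiv.trans (by ext; simp)

/-- A continuous function on an interval with vanishing derivative off a finite set is constant. -/
theorem eq_of_hasAlgDeriv_zero_off_finite {f : ℝ → A} {a b : ℝ} (S : Finset ℝ)
    (hcont : HasContCoeff f (Set.Icc a b))
    (h : ∀ t ∈ Set.Ioo a b, t ∉ S → HasAlgDeriv f 0 t) :
    ∀ t ∈ Set.Icc a b, f t = f a := by
  intro t ht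
  rw [← sub_eq_zero, ← Module.forall_dual_apply_eq_zero_iff ℂ]
  intro l
  have h1 : ∫ s in a..t, (0 : ℂ) = l (f t) - l (f a) := by
    refine MeasureTheory.integral_eq_of_hasDerivAt_off_countable_of_le
      (fun t => l (f t)) _ ht.1 S.countable_toSet
      ((hcont.map l).mono (Set.Icc_subset_Icc_right ht.2))
      (fun s hs => ?_) (by simp)
    have := (h s ⟨hs.1.1, hs.1.2.trans_le ht.2⟩ hs.2).map l
    rw [map_zero] at this
    exact this
  rw [map_sub, ← h1]
  simp

end AlgDeriv

/-! ### Series indexed by words -/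

section WordSeries

open Filter Topology

variable {n : ℕ} (k : ℕ)

/-- The homogeneous part of degree `l` of the series `∑ I(w) X_w`, where the coefficients are
indexed by reversed words. -/
def wordSum (I : List (Fin n) → ℂ) (l : ℕ) : Jets n k :=
  ∑ w : Fin l → Fin n, I (List.ofFn w).reverse • (List.ofFn fun i => Jets.X k (w i)).prod

/-- The series `∑ I(w) X_w` over words of length at most `k`, where the coefficients are indexed by
reversed words. -/
def wordSeries (I : List (Fin n) → ℂ) : Jets n k :=
  ∑ l ∈ Finset.range (k + 1), wordSum k I l

theorem wordSum_zero (I : List (Fin n) → ℂ) : wordSum k I 0 = I [] • 1 := by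
  simp [wordSum]

theorem wordSum_succ (I : List (Fin n) → ℂ) (l : ℕ) :
    wordSum k I (l + 1) = ∑ w : Fin l → Fin n, ∑ a : Fin n,
      I (a :: (List.ofFn w).reverse) •
        ((List.ofFn fun i => Jets.X k (w i)).prod * Jets.X k a) := by
  rw [wordSum, ← (Fin.snocEquiv fun _ => Fin n).sum_comp, Fintype.sum_prod_type_right]
  refine Finset.sum_congr rfl fun w _ => Finset.sum_congr rfl fun a _ => ?_
  rw [List.ofFn_succ', List.ofFn_succ']
  simp [Fin.snocEquiv]

theorem wordSum_mem (I : List (Fin n) → ℂ) (l : ℕ) : wordSum k I l ∈ jetFil n k l := by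
  refine Submodule.sum_mem _ fun w hw => Submodule.smul_mem _ _ ?_
  clear hw
  induction l with
  | zero => rw [jetFil_zero]; trivial
  | succ l ih =>
    rw [List.ofFn_succ, List.prod_cons]
    exact mul_mem_jetFil_of_eq (add_comm 1 l) (X_mem_jetFil _) (ih fun i => w i.succ)

theorem wordSeries_sub_one_mem {I : List (Fin n) → ℂ} (h : I [] = 1) :
    wordSeries k I - 1 ∈ jetFil n k 1 := by
  rw [wordSeries, Finset.sum_range_succ', wordSum_zero, h, one_smul, add_sub_cancel_right]
  exact Submodule.sum_mem _ fun l _ => jetFil_antitone (by omega) (wordSum_mem k I (l + 1))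

theorem wordSeries_sub_mem {I : List (Fin n) → ℂ} (h : I [] = 1) :
    wordSeries k I - 1 - ∑ a, I [a] • Jets.X k a ∈ jetFil n k 2 := by
  rcases Nat.eq_zero_or_pos k with rfl | hk
  · have h0 : ∀ x : Jets n 0, x ∈ jetFil n 0 1 → x ∈ jetFil n 0 2 := fun x hx => by
      rw [eq_zero_of_mem_jetFil one_pos hx]
      exact Submodule.zero_mem _
    exact h0 _ (Submodule.sub_mem _ (wordSeries_sub_one_mem 0 h)
      (Submodule.sum_mem _ fun a _ => Submodule.smul_mem _ _ (X_mem_jetFil a)))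
  · obtain ⟨m, rfl⟩ : ∃ m, k = m + 1 := ⟨k - 1, by omega⟩
    have h1 : wordSum (m + 1) I 1 = ∑ a, I [a] • Jets.X (m + 1) a := by
      rw [wordSum_succ]; simp
    rw [wordSeries, Finset.sum_range_succ', Finset.sum_range_succ', wordSum_zero, h, one_smul,
      add_sub_cancel_right, zero_add, h1, add_sub_cancel_right]
    exact Submodule.sum_mem _ fun l _ => jetFil_antitone (by omega) (wordSum_mem (m + 1) I _)

theorem hasContCoeff_wordSeries {X : Type} [TopologicalSpace X] {s : Set X}
    {I : List (Fin n) → X → ℂ} (h : ∀ w, ContinuousOn (I w) s) :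
    HasContCoeff (fun t => wordSeries k fun w => I w t) s :=
  HasContCoeff.sum _ fun _ _ => HasContCoeff.sum _ fun _ _ => HasContCoeff.smul_const (h _) _

theorem hasAlgDeriv_wordSum {𝕜 : Type} [NontriviallyNormedField 𝕜] [NormedAlgebra 𝕜 ℂ]
    {I : List (Fin n) → 𝕜 → ℂ} {φ : Fin n → ℂ} {x : 𝕜}
    (h : ∀ a w, HasDerivAt (I (a :: w)) (I w x * φ a) x) (l : ℕ) :
    HasAlgDeriv (fun t => wordSum k (fun w => I w t) (l + 1))
      (wordSum k (fun w => I w x) l * ∑ a, φ a • Jets.X k a) x := by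
  have e : ∀ w : Fin l → Fin n, ∀ a, HasAlgDeriv (A := Jets n k)
      (fun t => I (a :: (List.ofFn w).reverse) t •
        ((List.ofFn fun i => Jets.X k (w i)).prod * Jets.X k a))
      ((I (List.ofFn w).reverse x • (List.ofFn fun i => Jets.X k (w i)).prod) *
        (φ a • Jets.X k a)) x := fun w a => by
    rw [smul_mul_smul_comm]
    exact HasAlgDeriv.smul_const (h _ _) _
  have := HasAlgDeriv.sum Finset.univ fun w _ => HasAlgDeriv.sum Finset.univ fun a _ => e w a
  rw [← Finset.sum_mul_sum] at this
  refine this.congr (Eventually.of_forall fun t => ?_)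
  exact wordSum_succ k _ l

theorem wordSeries_mul (I : List (Fin n) → ℂ) {Ω : Jets n k} (hΩ : Ω ∈ jetFil n k 1) :
    wordSeries k I * Ω = ∑ l ∈ Finset.range k, wordSum k I l * Ω := by
  have h : wordSum k I k * Ω = 0 :=
    eq_zero_of_mem_jetFil (j := k + 1) (by omega) (mul_mem_jetFil (wordSum_mem k I k) hΩ)
  rw [wordSeries, Finset.sum_range_succ, add_mul, h, Finset.sum_mul, add_zero]

/-- If `I(a w)' = I(w) φ_a` for all words, then the series `f = ∑ I(w) X_w` solves the differential
equation `f' = f ∑ φ_a X_a`. -/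
theorem hasAlgDeriv_wordSeries {𝕜 : Type} [NontriviallyNormedField 𝕜] [NormedAlgebra 𝕜 ℂ]
    {I : List (Fin n) → 𝕜 → ℂ} {φ : Fin n → ℂ} {x : 𝕜} (h0 : HasDerivAt (I []) 0 x)
    (h : ∀ a w, HasDerivAt (I (a :: w)) (I w x * φ a) x) :
    HasAlgDeriv (fun t => wordSeries k fun w => I w t)
      ((wordSeries k fun w => I w x) * ∑ a, φ a • Jets.X k a) x := by
  have hz : HasAlgDeriv (fun t => wordSum k (fun w => I w t) 0) 0 x := by
    have h1 := HasAlgDeriv.smul_const h0 (1 : Jets n k)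
    rw [zero_smul] at h1
    refine h1.congr (Eventually.of_forall fun t => ?_)
    exact wordSum_zero k fun w => I w t
  have hΩ : ∑ a, φ a • Jets.X k a ∈ jetFil n k 1 :=
    Submodule.sum_mem _ fun a _ => Submodule.smul_mem _ _ (X_mem_jetFil a)
  have hsum := (HasAlgDeriv.sum (Finset.range k) fun l _ => hasAlgDeriv_wordSum k h l).add hz
  rw [add_zero, ← wordSeries_mul k _ hΩ] at hsum
  refine hsum.congr (Eventually.of_forall fun t => ?_)
  exact Finset.sum_range_succ' (fun l => wordSum k (fun w => I w t) l) k

end WordSeries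

/-! ### Holomorphic charts of a smooth fibre -/

section Charts

open Filter Topology

theorem hasFDerivAt_eval (F : Poly) (p : Fin 2 → ℂ) :
    HasFDerivAt (fun q : Fin 2 → ℂ => MvPolynomial.eval q F)
      (∑ i, MvPolynomial.eval p (MvPolynomial.pderiv i F) •
        (ContinuousLinearMap.proj i : (Fin 2 → ℂ) →L[ℂ] ℂ)) p := by
  induction F using MvPolynomial.induction_on with
  | C a =>
    have h : HasFDerivAt (fun _ : Fin 2 → ℂ => a) (0 : (Fin 2 → ℂ) →L[ℂ] ℂ) p :=
      hasFDerivAt_const a p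
    convert! h using 1
    · ext q
      simp
    · ext v
      simp
  | add f g hf hg =>
    convert! hf.add hg using 1
    · ext q
      simp
    · ext v
      simp [add_mul]
      ring
  | mul_X f i hf =>
    have h := hf.mul (hasFDerivAt_apply i p)
    simp only [map_mul, MvPolynomial.eval_X]
    convert! h using 1
    ext v
    simp only [MvPolynomial.pderiv_mul, map_add, map_mul, MvPolynomial.eval_X,
      MvPolynomial.pderiv_X, sum_apply, smul_apply,
      add_apply, ContinuousLinearMap.proj_apply, smul_eq_mul, add_mul,
      Finset.sum_add_distrib, Finset.mul_sum]
    rw [add_comm]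
    congr 1
    · rw [Finset.sum_eq_single i]
      · simp
      · intro b _ hb
        simp [hb.symm]
      · simp
    · exact Finset.sum_congr rfl fun _ _ => by ring

theorem contDiff_eval (F : Poly) : ContDiff ℂ 1 fun q : Fin 2 → ℂ => MvPolynomial.eval q F :=
  contDiff_iff_contDiffAt.2 fun p => (AnalyticOnNhd.eval_mvPolynomial F p trivial).contDiffAt

/-- A holomorphic chart of the fibre `F⁻¹(t)`: an open subset parametrized by a disc in one of the
two coordinates of `ℂ²`. -/
structure FiberChart (F : Poly) (t : ℂ) where
  /-- The domain of the chart. -/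
  domain : Set (Fiber F t)
  isOpen_domain : IsOpen domain
  /-- The coordinate of `ℂ²` that is used as the coordinate of the chart. -/
  coord : Fin 2
  /-- The centre of the disc. -/
  center : ℂ
  /-- The radius of the disc. -/
  radius : ℝ
  /-- The parametrization of the domain by the disc. -/
  param : ℂ → Fiber F t
  differentiableOn_param : DifferentiableOn ℂ (fun z => (param z).1) (Metric.ball center radius)
  param_mem : ∀ z ∈ Metric.ball center radius, param z ∈ domain
  coord_param : ∀ z ∈ Metric.ball center radius, (param z).1 coord = z
  coord_mem : ∀ q ∈ domain, q.1 coord ∈ Metric.ball center radius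
  param_coord : ∀ q ∈ domain, param (q.1 coord) = q

/-- The implicit function theorem for the curve `F = t` at a point where `F` is not critical. -/
theorem exists_fiberChart {F : Poly} {t : ℂ} (p : Fiber F t) {i : Fin 2}
    (hi : MvPolynomial.eval p.1 (MvPolynomial.pderiv i F) ≠ 0) :
    ∃ C : FiberChart F t, p ∈ C.domain := by
  obtain ⟨j, hij⟩ : ∃ j : Fin 2, j ≠ i := exists_ne i
  have huniv : ∀ f : Fin 2 → ℂ, ∑ l, f l = f i + f j := fun f => by
    have h : ∀ i j : Fin 2, j ≠ i → (Finset.univ : Finset (Fin 2)) = {i, j} := by decide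
    rw [h i j hij, Finset.sum_pair hij.symm]
  let Ψ : (Fin 2 → ℂ) → ℂ × ℂ := fun q => (q j, MvPolynomial.eval q F)
  let D : (Fin 2 → ℂ) →L[ℂ] ℂ × ℂ := (ContinuousLinearMap.proj j).prod
    (∑ l, MvPolynomial.eval p.1 (MvPolynomial.pderiv l F) •
        (ContinuousLinearMap.proj l : (Fin 2 → ℂ) →L[ℂ] ℂ))
  have hD : HasFDerivAt Ψ D p.1 := (hasFDerivAt_apply j p.1).prodMk (hasFDerivAt_eval F p.1)
  have hinj : Function.Injective D := by
    rw [injective_iff_map_eq_zero]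
    intro v hv
    have h1 : v j = 0 := congrArg Prod.fst hv
    have h2 : ∑ l, MvPolynomial.eval p.1 (MvPolynomial.pderiv l F) * v l = 0 := by
      have := congrArg Prod.snd hv
      simpa [D] using this
    rw [huniv, h1, mul_zero, add_zero] at h2
    have h3 := (mul_eq_zero.1 h2).resolve_left hi
    funext l
    have h4 : ∀ i j l : Fin 2, j ≠ i → l = i ∨ l = j := by decide
    rcases h4 i j l hij with rfl | rfl
    exacts [h3, h1]
  -- The map `q ↦ (q j, F q)` is a local biholomorphism at `p`, since `∂F/∂x_i ≠ 0`.
  let E : (Fin 2 → ℂ) ≃L[ℂ] ℂ × ℂ :=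
    (LinearEquiv.ofInjectiveOfFinrankEq (D : (Fin 2 → ℂ) →ₗ[ℂ] ℂ × ℂ) hinj
      (by simp)).toContinuousLinearEquiv
  have hE : HasFDerivAt Ψ (E : (Fin 2 → ℂ) →L[ℂ] ℂ × ℂ) p.1 := by
    have : (E : (Fin 2 → ℂ) →L[ℂ] ℂ × ℂ) = D := ContinuousLinearMap.ext fun v => rfl
    rwa [this]
  have hΨ : ContDiff ℂ 1 Ψ := (contDiff_apply ℂ ℂ j).prodMk (contDiff_eval F)
  let e := (hΨ.contDiffAt (x := p.1)).toOpenPartialHomeomorph Ψ hE (by norm_num)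
  have he : ∀ q, e q = Ψ q := fun q => rfl
  have hps : p.1 ∈ e.source :=
    (hΨ.contDiffAt (x := p.1)).mem_toOpenPartialHomeomorph_source hE (by norm_num)
  have hΨp : Ψ p.1 = (p.1 j, t) := Prod.ext rfl p.2
  have hpt : (p.1 j, t) ∈ e.target := by
    rw [← hΨp]
    exact e.map_source hps
  have hsymm : ContDiffAt ℂ 1 e.symm (p.1 j, t) := by
    have := (hΨ.contDiffAt (x := p.1)).to_localInverse hE (by norm_num)
    rwa [hΨp] at this
  have hev : ∀ᶠ z in 𝓝 (p.1 j), (z, t) ∈ e.target ∧ ContDiffAt ℂ 1 e.symm (z, t) := by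
    have hc : ContinuousAt (fun z : ℂ => (z, t)) (p.1 j) := by fun_prop
    exact hc.eventually ((e.open_target.eventually_mem hpt).and
      (hsymm.eventually (by simp)))
  obtain ⟨r, hr, hball⟩ := Metric.eventually_nhds_iff_ball.1 hev
  have hF : ∀ z ∈ Metric.ball (p.1 j) r, MvPolynomial.eval (e.symm (z, t)) F = t := fun z hz =>
    congrArg Prod.snd (e.right_inv (hball z hz).1)
  have hcoord : ∀ z ∈ Metric.ball (p.1 j) r, (e.symm (z, t)) j = z := fun z hz =>
    congrArg Prod.fst (e.right_inv (hball z hz).1)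
  classical
  -- Off the disc the value of the parametrization is irrelevant.
  let g : ℂ → Fiber F t := fun z =>
    if hz : MvPolynomial.eval (e.symm (z, t)) F = t then ⟨e.symm (z, t), hz⟩ else p
  have hg : ∀ z ∈ Metric.ball (p.1 j) r, (g z).1 = e.symm (z, t) := fun z hz => by
    simp only [g]
    rw [dif_pos (hF z hz)]
  refine ⟨{ domain := {q | q.1 ∈ e.source ∧ q.1 j ∈ Metric.ball (p.1 j) r}
            isOpen_domain := ?_
            coord := j
            center := p.1 j
            radius := r
            param := g
            differentiableOn_param := ?_
            param_mem := ?_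
            coord_param := ?_
            coord_mem := fun q hq => hq.2
            param_coord := ?_ }, hps, Metric.mem_ball_self hr⟩
  · have h1 : IsOpen {q : Fiber F t | q.1 ∈ e.source} :=
      e.open_source.preimage continuous_subtype_val
    have h2 : IsOpen {q : Fiber F t | q.1 j ∈ Metric.ball (p.1 j) r} :=
      Metric.isOpen_ball.preimage ((continuous_apply j).comp continuous_subtype_val)
    exact h1.inter h2
  · intro z hz
    have h1 : DifferentiableAt ℂ (fun z => e.symm (z, t)) z :=
      ((hball z hz).2.differentiableAt (by norm_num)).comp z (by fun_prop)
    exact h1.differentiableWithinAt.congr hg (hg z hz)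
  · intro z hz
    refine ⟨?_, ?_⟩
    · rw [hg z hz]
      exact e.map_target (hball z hz).1
    · rw [hg z hz, hcoord z hz]
      exact hz
  · intro z hz
    rw [hg z hz, hcoord z hz]
  · intro q hq
    refine Subtype.ext ?_
    rw [hg _ hq.2]
    have : (q.1 j, t) = e q.1 := by rw [he]; exact Prod.ext rfl q.2.symm
    rw [this, e.left_inv hq.1]

end Charts

/-! ### Parallel transport for a flat connection given by local frames -/

section FlatFrames

open Filter Topology unitInterval

/-- Local frames of a bundle with fibre the monoid `A` on which `A` acts by left multiplication:
over open sets covering `X`, functions with values in the units of `A` whose transition functions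
are locally constant. They describe a flat connection with the frames as horizontal sections. -/
structure FlatFrames (X A : Type) [TopologicalSpace X] [Monoid A] where
  /-- The index set of the frames. -/
  Index : Type
  /-- The open set on which a frame is defined. -/
  domain : Index → Set X
  isOpen_domain : ∀ i, IsOpen (domain i)
  /-- A frame that is defined at a given point. -/
  indexAt : X → Index
  mem_domain_indexAt : ∀ x, x ∈ domain (indexAt x)
  /-- The frame, a function with values in the units of `A`. -/
  frame : Index → X → Aˣ
  transition : ∀ i j, ∀ x ∈ domain i, x ∈ domain j →
    ∀ᶠ y in 𝓝 x, frame i y * (frame j y)⁻¹ = frame i x * (frame j x)⁻¹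

namespace FlatFrames

variable {X A : Type} [TopologicalSpace X] [Monoid A] (Z : FlatFrames X A)

/-- The function `J` along the path `c` is locally a constant multiple of the frames. -/
def IsHorizontal (c : I → X) (J : I → A) : Prop :=
  ∀ i s, c s ∈ Z.domain i → ∀ᶠ s' in 𝓝 s,
    J s' * ((Z.frame i (c s'))⁻¹ : Aˣ) = J s * ((Z.frame i (c s))⁻¹ : Aˣ)

variable {Z} in
theorem IsHorizontal.const_mul {c : I → X} {J : I → A} (h : Z.IsHorizontal c J) (a : A) :
    Z.IsHorizontal c fun s => a * J s := fun i s hs => by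
  filter_upwards [h i s hs] with s' hs'
  rw [mul_assoc, hs', mul_assoc]

section Covering

variable [TopologicalSpace A] [DiscreteTopology A]

/-- The bundle with discrete fibre `A` whose trivializations are the coordinates with respect to
the frames. -/
def core : FiberBundleCore Z.Index X A where
  baseSet := Z.domain
  isOpen_baseSet := Z.isOpen_domain
  indexAt := Z.indexAt
  mem_baseSet_at := Z.mem_domain_indexAt
  coordChange i j x v := v * (Z.frame i x * (Z.frame j x)⁻¹ : Aˣ)
  coordChange_self i x _ v := by simp
  continuousOn_coordChange i j := by
    rintro ⟨x, v⟩ ⟨⟨hi, hj⟩, -⟩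
    refine ContinuousAt.continuousWithinAt ?_
    have h : ContinuousAt (fun p : X × A => p.2 * (Z.frame i x * (Z.frame j x)⁻¹ : Aˣ)) (x, v) :=
      ((continuous_of_discreteTopology (f := fun a : A =>
        a * (Z.frame i x * (Z.frame j x)⁻¹ : Aˣ))).comp continuous_snd).continuousAt
    refine h.congr ?_
    filter_upwards [continuousAt_fst.eventually (Z.transition i j x hi hj)] with p hp
    rw [hp]
  coordChange_comp i j l x _ v := by
    rw [mul_assoc, ← Units.val_mul]
    group

theorem isCoveringMap_proj : IsCoveringMap Z.core.proj :=
  FiberBundle.isCoveringMap (F := A) (E := Z.core.Fiber)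

/-- The point of the covering space over `x` corresponding to the value `a` at `x`. -/
def point (x : X) (a : A) : Z.core.TotalSpace :=
  ⟨x, (a * ((Z.frame (Z.indexAt x) x)⁻¹ : Aˣ) : A)⟩

theorem point_injective (x : X) : Function.Injective (Z.point x) := fun a b h => by
  have h1 := (Bundle.TotalSpace.mk_inj).1 h
  exact (Units.mul_left_inj _).1 h1

theorem localTriv_point (i : Z.Index) (x : X) (a : A) :
    Z.core.localTriv i (Z.point x a) = (x, a * ((Z.frame i x)⁻¹ : Aˣ)) := by
  refine Prod.ext rfl ?_
  show a * ((Z.frame (Z.indexAt x) x)⁻¹ : Aˣ) *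
    (Z.frame (Z.indexAt x) x * (Z.frame i x)⁻¹ : Aˣ) = a * ((Z.frame i x)⁻¹ : Aˣ)
  rw [mul_assoc, ← Units.val_mul]
  group

variable {Z} in
theorem IsHorizontal.continuous_point {c : I → X} (hc : Continuous c) {J : I → A}
    (h : Z.IsHorizontal c J) : Continuous fun s => Z.point (c s) (J s) := by
  refine continuous_iff_continuousAt.2 fun s => ?_
  set i := Z.indexAt (c s)
  have hi : c s ∈ Z.domain i := Z.mem_domain_indexAt (c s)
  refine ((Z.core.localTriv i).toOpenPartialHomeomorph.continuousAt_iff_continuousAt_comp_left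
    ?_).2 ?_
  · exact hc.continuousAt.preimage_mem_nhds ((Z.isOpen_domain i).mem_nhds hi)
  · have h1 : ContinuousAt (fun s' => (c s', J s * ((Z.frame i (c s))⁻¹ : Aˣ))) s :=
      hc.continuousAt.prodMk continuousAt_const
    refine h1.congr ?_
    filter_upwards [h i s hi] with s' hs'
    exact ((Z.localTriv_point i _ _).trans (by rw [hs'])).symm

end Covering

variable {Z}

/-- Parallel transport depends only on the homotopy class of the path. -/
theorem IsHorizontal.eq_of_homotopic {x y : X} {c c' : Path x y} (hcc : c.Homotopic c')
    {J J' : I → A} (h : Z.IsHorizontal c J) (h' : Z.IsHorizontal c' J') (h0 : J 0 = J' 0) :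
    J 1 = J' 1 := by
  let _ : TopologicalSpace A := ⊥
  have : DiscreteTopology A := ⟨rfl⟩
  have e : ∀ {c : Path x y} {J : I → A} (_ : Z.IsHorizontal c J) (_ : J 0 = J' 0),
      (fun s => Z.point (c s) (J s)) =
        Z.isCoveringMap_proj.liftPath c.toContinuousMap (Z.point x (J' 0)) c.source :=
    fun {c J} h h0 =>
    (Z.isCoveringMap_proj.eq_liftPath_iff _).2
      ⟨h.continuous_point c.continuous, rfl, by rw [c.source, h0]⟩
  have h1 := Z.isCoveringMap_proj.liftPath_apply_one_eq_of_homotopicRel hcc (Z.point x (J' 0))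
    c.source c'.source
  rw [← congrFun (e h h0) 1, ← congrFun (e h' rfl) 1, c.target, c'.target] at h1
  exact Z.point_injective y h1

/-- Parallel transport along a concatenation is the product of the parallel transports. -/
theorem IsHorizontal.trans {x y z : X} {c : Path x y} {c' : Path y z} {J J' J'' : I → A}
    (h : Z.IsHorizontal c J) (h' : Z.IsHorizontal c' J') (h'' : Z.IsHorizontal (c.trans c') J'')
    (h0 : J 0 = 1) (h0' : J' 0 = 1) (h0'' : J'' 0 = 1) : J'' 1 = J 1 * J' 1 := by
  let _ : TopologicalSpace A := ⊥
  have : DiscreteTopology A := ⟨rfl⟩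
  let Γ : Path (Z.point x 1) (Z.point y (J 1)) :=
    { toFun := fun s => Z.point (c s) (J s)
      continuous_toFun := h.continuous_point c.continuous
      source' := by rw [c.source, h0]
      target' := by rw [c.target] }
  let Γ' : Path (Z.point y (J 1)) (Z.point z (J 1 * J' 1)) :=
    { toFun := fun s => Z.point (c' s) (J 1 * J' s)
      continuous_toFun := (h'.const_mul (J 1)).continuous_point c'.continuous
      source' := by rw [c'.source, h0', mul_one]
      target' := by rw [c'.target] }
  have e1 := (Z.isCoveringMap_proj.eq_liftPath_iff (γ := ((c.trans c' : Path x z) : C(I, X)))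
    (e := Z.point x 1) (c.trans c').source (Γ := Γ.trans Γ')).2
      ⟨(Γ.trans Γ').continuous, funext fun s => by
        show (Γ.trans Γ' s).1 = c.trans c' s
        simp only [Path.trans_apply]
        split_ifs <;> rfl, (Γ.trans Γ').source⟩
  have e2 := (Z.isCoveringMap_proj.eq_liftPath_iff (γ := ((c.trans c' : Path x z) : C(I, X)))
    (e := Z.point x 1) (c.trans c').source
      (Γ := fun s => Z.point (c.trans c' s) (J'' s))).2
      ⟨h''.continuous_point (c.trans c').continuous, rfl, by
        simp only [(c.trans c').source, h0'']⟩
  have h1 := (congrFun e2 1).trans (congrFun e1 1).symm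
  simp only [(c.trans c').target, (Γ.trans Γ').target] at h1
  exact Z.point_injective z h1

end FlatFrames

end FlatFrames

/-! ### The flat frames of a fibre defined by iterated primitives -/

section Frames

open Filter Topology

/-- The coefficient of the pullback of the one-form `η` under a map from `𝕜` to `ℂ²`. -/
def formAlong {𝕜 : Type} [NontriviallyNormedField 𝕜] [NormedAlgebra 𝕜 ℂ] (η : PolyForm)
    (f : 𝕜 → Fin 2 → ℂ) (x : 𝕜) : ℂ :=
  ∑ j, MvPolynomial.eval (f x) (η j) * deriv (fun v => f v j) x

theorem formAlong_eq_of_eventuallyEq_comp {𝕜 : Type} [NontriviallyNormedField 𝕜]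
    [NormedAlgebra 𝕜 ℂ] (η : PolyForm) {f : 𝕜 → Fin 2 → ℂ} {g : ℂ → Fin 2 → ℂ} {u : 𝕜 → ℂ}
    {u' : ℂ} {x : 𝕜} (h : f =ᶠ[𝓝 x] fun y => g (u y)) (hg : DifferentiableAt ℂ g (u x))
    (hu : HasDerivAt u u' x) : formAlong η f x = u' * formAlong η g (u x) := by
  rw [formAlong, formAlong, Finset.mul_sum]
  refine Finset.sum_congr rfl fun j _ => ?_
  have h1 : (fun v => f v j) =ᶠ[𝓝 x] fun y => g (u y) j := h.mono fun y hy => congrFun hy j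
  have h2 : HasDerivAt (fun z => g z j) (deriv (fun z => g z j) (u x)) (u x) :=
    (differentiableAt_pi.1 hg j).hasDerivAt
  have h3 : deriv (fun y => g (u y) j) x = deriv (fun z => g z j) (u x) * u' :=
    (h2.comp x hu).deriv
  rw [h.self_of_nhds, h1.deriv_eq, h3]
  ring

namespace FiberChart

variable {F : Poly} {t : ℂ} (C : FiberChart F t)

/-- The disc parametrizing the chart. -/
abbrev disc : Set ℂ := Metric.ball C.center C.radius

theorem differentiableAt_param {z : ℂ} (hz : z ∈ C.disc) :
    DifferentiableAt ℂ (fun z => (C.param z).1) z :=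
  (C.differentiableOn_param z hz).differentiableAt (Metric.isOpen_ball.mem_nhds hz)

theorem continuousAt_param {z : ℂ} (hz : z ∈ C.disc) : ContinuousAt C.param z :=
  Topology.IsInducing.subtypeVal.continuousAt_iff.2 (C.differentiableAt_param hz).continuousAt

theorem continuous_coord : Continuous fun q : Fiber F t => q.1 C.coord :=
  (continuous_apply C.coord).comp continuous_subtype_val

/-- The coefficient of a one-form in the coordinate of the chart. -/
def coeff (η : PolyForm) (z : ℂ) : ℂ := formAlong η (fun z => (C.param z).1) z

theorem differentiableOn_coeff (η : PolyForm) : DifferentiableOn ℂ (C.coeff η) C.disc := by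
  have h : ∀ j ∈ Finset.univ, DifferentiableOn ℂ (fun z =>
      MvPolynomial.eval (C.param z).1 (η j) * deriv (fun z => (C.param z).1 j) z) C.disc :=
    fun j _ => (((contDiff_eval (η j)).differentiable one_ne_zero).comp_differentiableOn
      C.differentiableOn_param).mul (DifferentiableOn.deriv (fun z hz =>
        (differentiableAt_pi.1 (C.differentiableAt_param hz) j).differentiableWithinAt)
        Metric.isOpen_ball)
  exact DifferentiableOn.fun_sum h

variable {n : ℕ} (η : Fin n → PolyForm)

theorem exists_primitives : ∃ I : List (Fin n) → ℂ → ℂ, (∀ z, I [] z = 1) ∧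
    ∀ a w, ∀ z ∈ C.disc, HasDerivAt (I (a :: w)) (I w z * C.coeff (η a) z) z := by
  have h : ∀ f : ℂ → ℂ, ∃ g : ℂ → ℂ, DifferentiableOn ℂ f C.disc →
      ∀ z ∈ C.disc, HasDerivAt g (f z) z := fun f => by
    by_cases hf : DifferentiableOn ℂ f C.disc
    · obtain ⟨g, hg⟩ := hf.isExactOn_ball
      exact ⟨g, fun _ => hg⟩
    · exact ⟨0, fun h => absurd h hf⟩
  choose prim hprim using h
  let I : List (Fin n) → ℂ → ℂ := fun w =>
    w.rec (fun _ => 1) fun a _ f => prim fun z => f z * C.coeff (η a) z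
  have hI : ∀ w, DifferentiableOn ℂ (I w) C.disc ∧
      ∀ a, ∀ z ∈ C.disc, HasDerivAt (I (a :: w)) (I w z * C.coeff (η a) z) z := fun w => by
    have step : ∀ w, DifferentiableOn ℂ (I w) C.disc →
        ∀ a, ∀ z ∈ C.disc, HasDerivAt (I (a :: w)) (I w z * C.coeff (η a) z) z := fun w hw a =>
      hprim (fun z => I w z * C.coeff (η a) z) (hw.mul (C.differentiableOn_coeff (η a)))
    induction w with
    | nil => exact ⟨differentiableOn_const 1, step [] (differentiableOn_const 1)⟩
    | cons a w ih =>
      have h1 : DifferentiableOn ℂ (I (a :: w)) C.disc := fun z hz =>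
        (ih.2 a z hz).differentiableAt.differentiableWithinAt
      exact ⟨h1, step (a :: w) h1⟩
  exact ⟨I, fun _ => rfl, fun a w => (hI w).2 a⟩

/-- Iterated primitives in the chart of the words in the one-forms `η`; the words are reversed, the
outermost integral being that of the first letter. -/
def primitive : List (Fin n) → ℂ → ℂ := (C.exists_primitives η).choose

theorem primitive_nil (z : ℂ) : C.primitive η [] z = 1 := (C.exists_primitives η).choose_spec.1 z

theorem hasDerivAt_primitive (a : Fin n) (w : List (Fin n)) {z : ℂ} (hz : z ∈ C.disc) :
    HasDerivAt (C.primitive η (a :: w)) (C.primitive η w z * C.coeff (η a) z) z :=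
  (C.exists_primitives η).choose_spec.2 a w z hz

theorem continuousOn_primitive (w : List (Fin n)) : ContinuousOn (C.primitive η w) C.disc := by
  cases w with
  | nil => simpa only [funext (C.primitive_nil η)] using continuousOn_const
  | cons a w => exact fun z hz => (C.hasDerivAt_primitive η a w hz).continuousAt.continuousWithinAt

variable (k : ℕ)

/-- The generating series of the iterated primitives. -/
def series (z : ℂ) : Jets n k := wordSeries k fun w => C.primitive η w z

/-- The inverse of the generating series of the iterated primitives. -/
def seriesInv (z : ℂ) : Jets n k := ∑ j ∈ Finset.range (k + 1), (1 - C.series η k z) ^ j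

theorem one_sub_series_pow (z : ℂ) : (1 - C.series η k z) ^ (k + 1) = 0 := by
  have h := sub_one_pow_eq_zero (wordSeries_sub_one_mem k (I := fun w => C.primitive η w z)
    (C.primitive_nil η z))
  rw [← neg_sub, neg_pow]
  exact (congrArg _ h).trans (mul_zero _)

/-- The generating series of the iterated primitives, as a unit. -/
def seriesUnit (z : ℂ) : (Jets n k)ˣ where
  val := C.series η k z
  inv := C.seriesInv η k z
  val_inv := by
    have := mul_neg_geom_sum (1 - C.series η k z) (k + 1)
    rwa [C.one_sub_series_pow, sub_zero, sub_sub_cancel] at this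
  inv_val := by
    have := geom_sum_mul_neg (1 - C.series η k z) (k + 1)
    rwa [C.one_sub_series_pow, sub_zero, sub_sub_cancel] at this

/-- The connection form `∑ η_a X_a` in the coordinate of the chart. -/
def connection (z : ℂ) : Jets n k := ∑ a, C.coeff (η a) z • Jets.X k a

theorem hasAlgDeriv_series {z : ℂ} (hz : z ∈ C.disc) :
    HasAlgDeriv (C.series η k) (C.series η k z * C.connection η k z) z := by
  refine hasAlgDeriv_wordSeries k ?_ fun a w => C.hasDerivAt_primitive η a w hz
  rw [funext (C.primitive_nil η)]
  exact hasDerivAt_const z 1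

theorem hasAlgDeriv_seriesInv {z : ℂ} (hz : z ∈ C.disc) :
    HasAlgDeriv (C.seriesInv η k) (-(C.connection η k z * C.seriesInv η k z)) z :=
  (C.hasAlgDeriv_series η k hz).exists_inverse (C.one_sub_series_pow η k)

/-- A solution of the connection equation along a curve in the chart, given in the coordinate `u`
of the chart, is locally a constant multiple of the generating series of iterated primitives. -/
theorem hasAlgDeriv_mul_seriesInv {𝕜 : Type} [NontriviallyNormedField 𝕜] [NormedAlgebra 𝕜 ℂ]
    {f : 𝕜 → Fin 2 → ℂ} {J : 𝕜 → Jets n k} {u : 𝕜 → ℂ} {u' : ℂ} {x : 𝕜} (hx : u x ∈ C.disc)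
    (hf : f =ᶠ[𝓝 x] fun y => (C.param (u y)).1) (hu : HasDerivAt u u' x)
    (hJ : HasAlgDeriv J (J x * ∑ a, formAlong (η a) f x • Jets.X k a) x) :
    HasAlgDeriv (fun y => J y * C.seriesInv η k (u y)) 0 x := by
  have h1 : ∑ a, formAlong (η a) f x • Jets.X k a = u' • C.connection η k (u x) := by
    rw [connection, Finset.smul_sum]
    refine Finset.sum_congr rfl fun a _ => ?_
    rw [smul_smul, coeff,
      formAlong_eq_of_eventuallyEq_comp (η a) hf (C.differentiableAt_param hx) hu]
  have h2 := hJ.mul ((C.hasAlgDeriv_seriesInv η k hx).comp hu)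
  convert h2 using 1
  rw [h1]
  simp only [mul_smul_comm, smul_mul_assoc, mul_neg, smul_neg, mul_assoc, add_neg_cancel]

theorem eventually_transition (D : FiberChart F t) {x : Fiber F t} (hC : x ∈ C.domain)
    (hD : x ∈ D.domain) : ∀ᶠ y in 𝓝 x,
      C.seriesUnit η k (y.1 C.coord) * (D.seriesUnit η k (y.1 D.coord))⁻¹ =
        C.seriesUnit η k (x.1 C.coord) * (D.seriesUnit η k (x.1 D.coord))⁻¹ := by
  have hz := C.coord_mem x hC
  have hev : ∀ᶠ z in 𝓝 (x.1 C.coord), z ∈ C.disc ∧ C.param z ∈ D.domain := by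
    refine (Metric.isOpen_ball.eventually_mem hz).and ?_
    refine (C.continuousAt_param hz).eventually (D.isOpen_domain.eventually_mem ?_)
    rwa [C.param_coord x hC]
  obtain ⟨r, hr, hball⟩ := Metric.eventually_nhds_iff_ball.1 hev
  have hconst : ∀ z ∈ Metric.ball (x.1 C.coord) r, HasAlgDeriv
      (fun z => C.series η k z * D.seriesInv η k ((C.param z).1 D.coord)) 0 z := fun z hz => by
    refine D.hasAlgDeriv_mul_seriesInv η k (f := fun z => (C.param z).1)
      (u := fun z => (C.param z).1 D.coord) (D.coord_mem _ (hball z hz).2) ?_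
      (differentiableAt_pi.1 (C.differentiableAt_param (hball z hz).1) D.coord).hasDerivAt
      (C.hasAlgDeriv_series η k (hball z hz).1)
    filter_upwards [Metric.isOpen_ball.eventually_mem hz] with y hy
    rw [D.param_coord _ (hball y hy).2]
  have h1 : ∀ᶠ y in 𝓝 x, y.1 C.coord ∈ Metric.ball (x.1 C.coord) r :=
    C.continuous_coord.continuousAt.eventually
      (Metric.isOpen_ball.eventually_mem (Metric.mem_ball_self hr))
  filter_upwards [h1, C.isOpen_domain.eventually_mem hC] with y hy hyC
  have h2 := eq_of_hasAlgDeriv_zero Metric.isOpen_ball (convex_ball _ _) hconst hy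
    (Metric.mem_ball_self hr)
  simp only [C.param_coord y hyC, C.param_coord x hC] at h2
  exact Units.ext h2

end FiberChart

/-- The flat frames of a smooth fibre: the generating series of iterated primitives in the
charts. -/
def fiberFrames {F : Poly} {t : ℂ} (hF : ∀ p : Fiber F t, ∃ C : FiberChart F t, p ∈ C.domain)
    {n : ℕ} (η : Fin n → PolyForm) (k : ℕ) : FlatFrames (Fiber F t) (Jets n k) where
  Index := FiberChart F t
  domain := FiberChart.domain
  isOpen_domain := FiberChart.isOpen_domain
  indexAt p := (hF p).choose
  mem_domain_indexAt p := (hF p).choose_spec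
  frame C p := C.seriesUnit η k (p.1 C.coord)
  transition C D _ hC hD := C.eventually_transition η k D hC hD

end Frames

/-! ### Iterated integrals along piecewise continuously differentiable paths -/

section PathTransport

open Filter Topology MeasureTheory

variable {F : Poly} {t : ℂ} {p q r : Fiber F t}

/-- The path is continuously differentiable off the finite set `S`, with one-sided derivatives at
the points of `S`. -/
def IsC1Off (S : Finset ℝ) (c : Path p q) : Prop :=
  ∀ a b : ℝ, 0 ≤ a → a < b → b ≤ 1 → (∀ u ∈ Set.Ioo a b, u ∉ S) →
    ContDiffOn ℝ 1 (ambient c) (Set.Icc a b)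

theorem continuous_ambient (c : Path p q) : Continuous (ambient c) :=
  continuous_subtype_val.comp c.continuous_extend

theorem isOpen_Ioo_diff (S : Finset ℝ) : IsOpen (Set.Ioo (0 : ℝ) 1 \ S) :=
  isOpen_Ioo.sdiff S.finite_toSet.isClosed

namespace IsC1Off

variable {S : Finset ℝ} {c : Path p q}

theorem contDiffOn (h : IsC1Off S c) : ContDiffOn ℝ 1 (ambient c) (Set.Ioo (0 : ℝ) 1 \ S) := by
  intro u hu
  obtain ⟨ε, hε, hb⟩ := Metric.isOpen_iff.1 (isOpen_Ioo_diff S) u hu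
  have hsub : ∀ v, |v - u| ≤ ε / 2 → v ∈ Set.Ioo (0 : ℝ) 1 \ S := fun v hv =>
    hb (by rw [Metric.mem_ball, Real.dist_eq]; linarith)
  have h1 := h (u - ε / 2) (u + ε / 2)
    (hsub (u - ε / 2) (by rw [abs_le]; constructor <;> linarith)).1.1.le (by linarith)
    (hsub (u + ε / 2) (by rw [abs_le]; constructor <;> linarith)).1.2.le
    fun v hv => (hsub v (by rw [abs_le]; constructor <;> linarith [hv.1, hv.2])).2
  exact (h1.contDiffAt (Icc_mem_nhds (by linarith) (by linarith))).contDiffWithinAt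

theorem continuousOn_pullback (h : IsC1Off S c) (η : PolyForm) :
    ContinuousOn (pullback η c) (Set.Ioo (0 : ℝ) 1 \ S) := by
  refine continuousOn_finsetSum _ fun j _ => ContinuousOn.mul ?_ ?_
  · exact ((contDiff_eval (η j)).continuous.comp (continuous_ambient c)).continuousOn
  · exact (contDiffOn_pi.1 h.contDiffOn j).continuousOn_deriv_of_isOpen (isOpen_Ioo_diff S) le_rfl

theorem integrableOn_pullback_piece (h : IsC1Off S c) (η : PolyForm) {a b : ℝ} (ha : 0 ≤ a)
    (hb : b ≤ 1) (hS : ∀ u ∈ Set.Ioo a b, u ∉ S) : IntegrableOn (pullback η c) (Set.Icc a b) := by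
  rcases lt_trichotomy a b with hab | rfl | hab
  · have hd := contDiffOn_pi.1 (h a b ha hab hb hS)
    have hcont : ContinuousOn (fun u => ∑ j, MvPolynomial.eval (ambient c u) (η j) *
        derivWithin (fun v => ambient c v j) (Set.Icc a b) u) (Set.Icc a b) := by
      refine continuousOn_finsetSum _ fun j _ => ContinuousOn.mul ?_ ?_
      · exact ((contDiff_eval (η j)).continuous.comp (continuous_ambient c)).continuousOn
      · exact (hd j).continuousOn_derivWithin (uniqueDiffOn_Icc hab) le_rfl
    have hint := hcont.integrableOn_Icc (μ := volume)
    rw [integrableOn_Icc_iff_integrableOn_Ioo] at hint ⊢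
    refine hint.congr_fun (fun u hu => ?_) measurableSet_Ioo
    refine Finset.sum_congr rfl fun j _ => ?_
    rw [derivWithin_of_mem_nhds (Icc_mem_nhds hu.1 hu.2)]
  · simp
  · simp [Set.Icc_eq_empty hab.not_ge]

theorem integrableOn_pullback (h : IsC1Off S c) (η : PolyForm) :
    IntegrableOn (pullback η c) (Set.Icc 0 1) := by
  refine LocallyIntegrableOn.integrableOn_isCompact (fun x hx => ?_) isCompact_Icc
  have hopen : IsOpen ((S.erase x : Finset ℝ) : Set ℝ)ᶜ :=
    (S.erase x).finite_toSet.isClosed.isOpen_compl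
  obtain ⟨ε, hε, hb⟩ := Metric.isOpen_iff.1 hopen x (by simp)
  -- Near `x` the only possible point of `S` is `x` itself, so the function is integrable on both
  -- sides of `x`.
  have hS : ∀ u, |u - x| < ε → u ≠ x → u ∉ S := fun u hu hne hmem =>
    hb (show u ∈ Metric.ball x ε by rwa [Metric.mem_ball, Real.dist_eq])
      (Finset.mem_coe.2 (Finset.mem_erase.2 ⟨hne, hmem⟩))
  have h1 := h.integrableOn_pullback_piece η (a := max 0 (x - ε)) (b := x) (le_max_left _ _) hx.2
    fun u hu => hS u (by
      rw [abs_lt]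
      have := (le_max_right 0 (x - ε)).trans_lt hu.1
      constructor <;> linarith [hu.2]) hu.2.ne
  have h2 := h.integrableOn_pullback_piece η (a := x) (b := min 1 (x + ε)) hx.1 (min_le_left _ _)
    fun u hu => hS u (by
      rw [abs_lt]
      have := hu.2.trans_le (min_le_right 1 (x + ε))
      constructor <;> linarith [hu.1]) hu.1.ne'
  refine ⟨_, ?_, h1.union h2⟩
  rw [mem_nhdsWithin]
  refine ⟨Metric.ball x ε, Metric.isOpen_ball, Metric.mem_ball_self hε, fun u hu => ?_⟩
  have hu1 := hu.1
  rw [Metric.mem_ball, Real.dist_eq, abs_lt] at hu1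
  rcases le_total u x with hux | hux
  · exact Or.inl ⟨max_le hu.2.1 (by linarith), hux⟩
  · exact Or.inr ⟨hux, le_min hu.2.2 (by linarith)⟩

theorem continuousOn_iterAux (h : IsC1Off S c) {n : ℕ} (η : Fin n → PolyForm)
    (w : List (Fin n)) :
    ContinuousOn (iterAux (w.map fun a => pullback (η a) c)) (Set.Icc 0 1) := by
  induction w with
  | nil => exact continuousOn_const
  | cons a w ih =>
    have hint : IntegrableOn (fun u => iterAux (w.map fun a => pullback (η a) c) u *
        pullback (η a) c u) (Set.Icc 0 1) :=
      (h.integrableOn_pullback (η a)).continuousOn_mul ih isCompact_Icc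
    rw [← Set.uIcc_of_le zero_le_one] at hint ⊢
    exact intervalIntegral.continuousOn_primitive_interval hint

theorem hasDerivAt_iterAux (h : IsC1Off S c) {n : ℕ} (η : Fin n → PolyForm) (a : Fin n)
    (w : List (Fin n)) {u : ℝ} (hu : u ∈ Set.Ioo (0 : ℝ) 1 \ S) :
    HasDerivAt (iterAux ((a :: w).map fun a => pullback (η a) c))
      (iterAux (w.map fun a => pullback (η a) c) u * pullback (η a) c u) u := by
  have ih := h.continuousOn_iterAux η w
  have hint : IntegrableOn (fun u => iterAux (w.map fun a => pullback (η a) c) u *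
      pullback (η a) c u) (Set.Icc 0 1) :=
    (h.integrableOn_pullback (η a)).continuousOn_mul ih isCompact_Icc
  have hcont : ContinuousOn (fun u => iterAux (w.map fun a => pullback (η a) c) u *
      pullback (η a) c u) (Set.Ioo (0 : ℝ) 1 \ S) :=
    (ih.mono (Set.sdiff_subset.trans Set.Ioo_subset_Icc_self)).mul (h.continuousOn_pullback (η a))
  refine intervalIntegral.integral_hasDerivAt_right ?_
    (hcont.stronglyMeasurableAtFilter (isOpen_Ioo_diff S) u hu)
    (hcont.continuousAt ((isOpen_Ioo_diff S).mem_nhds hu))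
  rw [intervalIntegrable_iff_integrableOn_Icc_of_le hu.1.1.le]
  exact hint.mono_set (Set.Icc_subset_Icc_right hu.1.2.le)

end IsC1Off

variable {n : ℕ} (k : ℕ) (η : Fin n → PolyForm)

/-- The truncated Chen series of the restriction of the path to `[0, s]`. -/
def chenTransport (c : Path p q) (s : ℝ) : Jets n k :=
  wordSeries k fun w => iterAux (w.map fun a => pullback (η a) c) s

theorem chenTransport_zero (c : Path p q) : chenTransport k η c 0 = 1 := by
  have h : ∀ w : List (Fin n), w ≠ [] → iterAux (w.map fun a => pullback (η a) c) 0 = 0 := by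
    rintro (_ | ⟨a, w⟩) hw
    · exact absurd rfl hw
    · exact intervalIntegral.integral_same
  rw [chenTransport, wordSeries, Finset.sum_range_succ', wordSum_zero]
  have h0 : ∀ l ∈ Finset.range k,
      wordSum k (fun w => iterAux (w.map fun a => pullback (η a) c) 0) (l + 1) = 0 := fun l _ =>
    Finset.sum_eq_zero fun w _ => by
      dsimp only
      rw [h _ (by simp), zero_smul]
  rw [Finset.sum_eq_zero h0]
  simp [iterAux]

theorem chenTransport_one (c : Path p q) : chenTransport k η c 1 = chenSeries k η c := by
  rw [chenTransport, wordSeries, chenSeries, Finset.sum_range_succ', wordSum_zero, add_comm,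
    Finset.range_eq_Ico,
    Finset.sum_Ico_add'
      (fun l => wordSum k (fun w => iterAux (w.map fun a => pullback (η a) c) 1) l) 0 k 1]
  congr 1
  · simp [iterAux]
  · rw [zero_add, ← Finset.Ico_succ_right_eq_Icc]
    refine Finset.sum_congr rfl fun l _ => Finset.sum_congr rfl fun w _ => ?_
    dsimp only
    rw [iterInt, List.map_reverse, List.map_ofFn, List.map_ofFn]
    rfl

/-- The truncated Chen series along a piecewise continuously differentiable path in a fibre is
parallel transport for the flat frames given by iterated primitives. -/
theorem isHorizontal_chenTransport (hF : ∀ p : Fiber F t, ∃ C : FiberChart F t, p ∈ C.domain)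
    {c : Path p q} (hc : IsPiecewiseC1 c) :
    (fiberFrames hF η k).IsHorizontal c fun s => chenTransport k η c s := by
  obtain ⟨S, h⟩ : ∃ S, IsC1Off S c := hc
  intro C s hs
  change FiberChart F t at C
  change c s ∈ C.domain at hs
  rw [← c.extend_extends' s] at hs
  obtain ⟨ε, hε, hball⟩ := Metric.eventually_nhds_iff_ball.1
    (c.continuous_extend.continuousAt.eventually (C.isOpen_domain.eventually_mem hs))
  set z : ℝ → ℂ := fun u => ambient c u C.coord with hz
  have hzc : Continuous z := (continuous_apply _).comp (continuous_ambient c)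
  have hzmem : ∀ u ∈ Metric.ball (s : ℝ) ε, z u ∈ C.disc := fun u hu => C.coord_mem _ (hball u hu)
  have key : ∀ a b : ℝ, 0 ≤ a → b ≤ 1 → Set.Icc a b ⊆ Metric.ball (s : ℝ) ε →
      ∀ u ∈ Set.Icc a b, chenTransport k η c u * C.seriesInv η k (z u) =
        chenTransport k η c a * C.seriesInv η k (z a) := by
    intro a b ha hb hab
    refine eq_of_hasAlgDeriv_zero_off_finite S
      (f := fun u => chenTransport k η c u * C.seriesInv η k (z u)) ?_ fun u hu huS => ?_
    · have h1 : HasContCoeff (fun u => C.series η k (z u)) (Set.Icc a b) :=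
        hasContCoeff_wordSeries k fun w => (C.continuousOn_primitive η w).comp hzc.continuousOn
          fun u hu => hzmem u (hab hu)
      refine (hasContCoeff_wordSeries k fun w => (h.continuousOn_iterAux η w).mono
        (Set.Icc_subset_Icc ha hb)).mul (HasContCoeff.sum _ fun j _ => HasContCoeff.pow ?_ j)
      have h2 := (HasContCoeff.const (Set.Icc a b) (1 : Jets n k)).add
        ((HasContCoeff.const (Set.Icc a b) (-1 : Jets n k)).mul h1)
      simpa only [neg_mul, one_mul, ← sub_eq_add_neg] using h2
    · have hu' : u ∈ Set.Ioo (0 : ℝ) 1 \ S := ⟨⟨ha.trans_lt hu.1, hu.2.trans_le hb⟩, huS⟩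
      have hub := hab (Set.Ioo_subset_Icc_self hu)
      refine C.hasAlgDeriv_mul_seriesInv η k (f := ambient c) (u := z) (hzmem u hub) ?_
        (((contDiffOn_pi.1 h.contDiffOn C.coord).contDiffAt
          ((isOpen_Ioo_diff S).mem_nhds hu')).differentiableAt one_ne_zero).hasDerivAt
        (hasAlgDeriv_wordSeries k (hasDerivAt_const u 1) fun a w => h.hasDerivAt_iterAux η a w hu')
      filter_upwards [Metric.isOpen_ball.eventually_mem hub] with v hv
      exact (congrArg Subtype.val (C.param_coord _ (hball v hv))).symm
  have hev : ∀ᶠ s' : unitInterval in 𝓝 s, (s' : ℝ) ∈ Metric.ball (s : ℝ) ε :=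
    continuous_subtype_val.continuousAt.eventually
      (Metric.isOpen_ball.eventually_mem (Metric.mem_ball_self hε))
  filter_upwards [hev] with s' hs'
  have hsub : Set.Icc (min (s : ℝ) s') (max (s : ℝ) s') ⊆ Metric.ball (s : ℝ) ε :=
    ((convex_ball (s : ℝ) ε).ordConnected.uIcc_subset (Metric.mem_ball_self hε) hs')
  have e := key _ _ (le_min s.2.1 s'.2.1) (max_le s.2.2 s'.2.2) hsub
  have e1 := (e s' ⟨min_le_right _ _, le_max_right _ _⟩).trans
    (e s ⟨min_le_left _ _, le_max_left _ _⟩).symm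
  simp only [hz, ambient, c.extend_extends'] at e1
  exact e1

/-- Iterated integrals over piecewise continuously differentiable paths depend only on the homotopy
class. -/
theorem chenSeries_eq_of_homotopic (hF : ∀ p : Fiber F t, ∃ C : FiberChart F t, p ∈ C.domain)
    {c c' : Path p q} (hc : IsPiecewiseC1 c) (hc' : IsPiecewiseC1 c') (h : c.Homotopic c') :
    chenSeries k η c = chenSeries k η c' := by
  rw [← chenTransport_one, ← chenTransport_one]
  exact (isHorizontal_chenTransport k η hF hc).eq_of_homotopic h
    (isHorizontal_chenTransport k η hF hc') (by simp [chenTransport_zero])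

theorem chenSeries_trans (hF : ∀ p : Fiber F t, ∃ C : FiberChart F t, p ∈ C.domain)
    {c : Path p q} {c' : Path q r} (hc : IsPiecewiseC1 c) (hc' : IsPiecewiseC1 c')
    (hcc' : IsPiecewiseC1 (c.trans c')) :
    chenSeries k η (c.trans c') = chenSeries k η c * chenSeries k η c' := by
  rw [← chenTransport_one, ← chenTransport_one, ← chenTransport_one]
  exact (isHorizontal_chenTransport k η hF hc).trans (isHorizontal_chenTransport k η hF hc')
    (isHorizontal_chenTransport k η hF hcc') (by simp [chenTransport_zero])
    (by simp [chenTransport_zero]) (by simp [chenTransport_zero])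

end PathTransport

/-! ### Piecewise continuously differentiable representatives -/

section Representatives

open Filter Topology unitInterval

variable {F : Poly} {t : ℂ} {p q r : Fiber F t}

theorem isPiecewiseC1_refl (p : Fiber F t) : IsPiecewiseC1 (Path.refl p) :=
  ⟨∅, fun _ _ _ _ _ _ => contDiffOn_const (c := p.1)⟩

theorem IsPiecewiseC1.trans {c : Path p q} {c' : Path q r} (hc : IsPiecewiseC1 c)
    (hc' : IsPiecewiseC1 c') : IsPiecewiseC1 (c.trans c') := by
  classical
  obtain ⟨S, hS⟩ := hc
  obtain ⟨S', hS'⟩ := hc'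
  refine ⟨insert (1 / 2) (S.image (fun u => u / 2) ∪ S'.image fun u => (u + 1) / 2),
    fun a b ha hab hb h => ?_⟩
  simp only [Finset.mem_insert, Finset.mem_union, Finset.mem_image, not_or] at h
  rcases le_or_gt b (1 / 2) with hb2 | hb2
  · have h1 := hS (2 * a) (2 * b) (by linarith) (by linarith) (by linarith) fun u hu hmem =>
      (h (u / 2) ⟨by linarith [hu.1], by linarith [hu.2]⟩).2.1 ⟨u, hmem, rfl⟩
    have h2 : ContDiff ℝ 1 fun u : ℝ => 2 * u := by fun_prop
    refine (h1.comp h2.contDiffOn fun u hu => ⟨by linarith [hu.1], by linarith [hu.2]⟩).congr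
      fun u hu => ?_
    exact congrArg Subtype.val (Path.extend_trans_of_le_half c c' (hu.2.trans hb2))
  · have ha2 : 1 / 2 ≤ a := by
      by_contra! hlt
      exact (h (1 / 2) ⟨hlt, hb2⟩).1 rfl
    have h1 := hS' (2 * a - 1) (2 * b - 1) (by linarith) (by linarith) (by linarith)
      fun u hu hmem => (h ((u + 1) / 2) ⟨by linarith [hu.1], by linarith [hu.2]⟩).2.2 ⟨u, hmem, rfl⟩
    have h2 : ContDiff ℝ 1 fun u : ℝ => 2 * u - 1 := by fun_prop
    refine (h1.comp h2.contDiffOn fun u hu => ⟨by linarith [hu.1], by linarith [hu.2]⟩).congr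
      fun u hu => ?_
    exact congrArg Subtype.val (Path.extend_trans_of_half_le c c' (ha2.trans hu.1))

namespace FiberChart

variable (C : FiberChart F t)

/-- A path in a chart is homotopic to the image of a segment. -/
theorem exists_isPiecewiseC1_homotopic {x y : Fiber F t} (d : Path x y)
    (hd : ∀ u, d u ∈ C.domain) : ∃ d' : Path x y, IsPiecewiseC1 d' ∧ d'.Homotopic d := by
  have hx : x ∈ C.domain := by simpa using hd 0
  have hy : y ∈ C.domain := by simpa using hd 1
  obtain ⟨⟨z, hz⟩, rfl⟩ : ∃ z : C.disc, C.param z = x := ⟨⟨_, C.coord_mem x hx⟩, C.param_coord x hx⟩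
  obtain ⟨⟨w, hw⟩, rfl⟩ : ∃ z : C.disc, C.param z = y := ⟨⟨_, C.coord_mem y hy⟩, C.param_coord y hy⟩
  have hconv : Convex ℝ C.disc := convex_ball _ _
  have : ContractibleSpace C.disc := hconv.contractibleSpace ⟨z, hz⟩
  have hφ : Continuous fun v : C.disc => C.param v := continuous_iff_continuousAt.2 fun v =>
    (C.continuousAt_param v.2).comp continuous_subtype_val.continuousAt
  let e : Path (⟨z, hz⟩ : C.disc) ⟨w, hw⟩ :=
    { toFun := fun u => ⟨(d u).1 C.coord, C.coord_mem _ (hd u)⟩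
      continuous_toFun := (C.continuous_coord.comp d.continuous).subtype_mk _
      source' := Subtype.ext (by simpa using C.coord_param z hz)
      target' := Subtype.ext (by simpa using C.coord_param w hw) }
  let e' : Path (⟨z, hz⟩ : C.disc) ⟨w, hw⟩ :=
    { toFun := fun u => ⟨AffineMap.lineMap z w (u : ℝ), hconv.lineMap_mem hz hw u.2⟩
      continuous_toFun := (AffineMap.lineMap_continuous.comp continuous_subtype_val).subtype_mk _
      source' := Subtype.ext (by simp)
      target' := Subtype.ext (by simp) }
  have hed : e.map hφ = d := Path.ext (funext fun u => C.param_coord _ (hd u))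
  refine ⟨e'.map hφ, ⟨∅, fun a b ha _ hb _ => ?_⟩, ?_⟩
  · have h1 : ContDiffOn ℝ 1 (fun v => (C.param v).1) C.disc :=
      (C.differentiableOn_param.contDiffOn Metric.isOpen_ball).restrict_scalars ℝ
    have h2 : ContDiff ℝ 1 fun u : ℝ => AffineMap.lineMap z w u := by
      simp only [AffineMap.lineMap_apply_module]
      fun_prop
    have hsub : Set.Icc a b ⊆ Set.Icc 0 1 := Set.Icc_subset_Icc ha hb
    refine (h1.comp h2.contDiffOn fun u hu => hconv.lineMap_mem hz hw (hsub hu)).congr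
      fun u hu => ?_
    rw [ambient, Path.extend_apply _ (hsub hu)]
    rfl
  · rw [← hed]
    exact (SimplyConnectedSpace.paths_homotopic e' e).map ⟨_, hφ⟩

end FiberChart

/-- Every path in a smooth fibre is homotopic to a piecewise continuously differentiable one. -/
theorem exists_isPiecewiseC1_homotopic (hF : ∀ p : Fiber F t, ∃ C : FiberChart F t, p ∈ C.domain)
    (c : Path p q) : ∃ d : Path p q, IsPiecewiseC1 d ∧ d.Homotopic c := by
  obtain ⟨s, hs0, hmono, ⟨N, hN⟩, hs⟩ := exists_monotone_Icc_subset_open_cover_unitInterval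
    (c := fun C : FiberChart F t => c ⁻¹' C.domain)
    (fun C => C.isOpen_domain.preimage c.continuous) fun u _ => by
      obtain ⟨C, hC⟩ := hF (c u)
      exact Set.mem_iUnion.2 ⟨C, hC⟩
  have key : ∀ m v, v = s m → ∃ d : Path (c 0) (c v), IsPiecewiseC1 d ∧
      d.Homotopic (c.subpath 0 v) := by
    intro m
    induction m with
    | zero =>
      intro v hv
      rw [hs0] at hv
      subst hv
      refine ⟨Path.refl _, isPiecewiseC1_refl _, ?_⟩
      rw [Path.subpath_self]
    | succ m ih =>
      rintro v rfl
      obtain ⟨d, hd, hdc⟩ := ih (s m) rfl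
      obtain ⟨C, hC⟩ := hs m
      obtain ⟨d', hd', hdc'⟩ := C.exists_isPiecewiseC1_homotopic (c.subpath (s m) (s (m + 1)))
        fun u => by
          have : c.subpath (s m) (s (m + 1)) u ∈ Set.range (c.subpath (s m) (s (m + 1))) := ⟨u, rfl⟩
          rw [Path.range_subpath_of_le _ _ _ (hmono m.le_succ)] at this
          obtain ⟨v, hv, hvu⟩ := this
          rw [← hvu]
          exact hC hv
      exact ⟨d.trans d', hd.trans hd', (hdc.hcomp hdc').trans
        ⟨Path.Homotopy.subpathTransSubpath c 0 (s m) (s (m + 1))⟩⟩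
  obtain ⟨d, hd, hdc⟩ := key N 1 (hN N le_rfl).symm
  refine ⟨d.cast c.source.symm c.target.symm, hd, ?_⟩
  rw [Path.subpath_zero_one] at hdc
  exact hdc

end Representatives

/-! ### The Chen expansion of the fundamental group -/

section Expansion

variable {F : Poly} {t : ℂ} {p : Fiber F t}

theorem loopClass_trans (c c' : Path p p) :
    loopClass (c.trans c') = loopClass c' * loopClass c := rfl

theorem homotopic_of_loopClass_eq {c c' : Path p p} (h : loopClass c = loopClass c') :
    c.Homotopic c' :=
  Path.Homotopic.Quotient.exact h

theorem exists_loopClass_eq (hF : ∀ p : Fiber F t, ∃ C : FiberChart F t, p ∈ C.domain)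
    (σ : FundamentalGroup (Fiber F t) p) : ∃ c : Path p p, IsPiecewiseC1 c ∧ loopClass c = σ := by
  obtain ⟨c, rfl⟩ : ∃ c : Path p p, loopClass c = σ := Quotient.exists_rep σ
  obtain ⟨d, hd, hdc⟩ := exists_isPiecewiseC1_homotopic hF c
  exact ⟨d, hd, Quotient.sound hdc⟩

theorem isPiecewiseC1_representative
    (hF : ∀ p : Fiber F t, ∃ C : FiberChart F t, p ∈ C.domain)
    (σ : FundamentalGroup (Fiber F t) p) : IsPiecewiseC1 (representative σ) := by
  rw [representative, dif_pos (exists_loopClass_eq hF σ)]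
  exact (exists_loopClass_eq hF σ).choose_spec.1

theorem loopClass_representative (hF : ∀ p : Fiber F t, ∃ C : FiberChart F t, p ∈ C.domain)
    (σ : FundamentalGroup (Fiber F t) p) : loopClass (representative σ) = σ := by
  rw [representative, dif_pos (exists_loopClass_eq hF σ)]
  exact (exists_loopClass_eq hF σ).choose_spec.2

variable {n : ℕ} (k : ℕ) (η : Fin n → PolyForm)

theorem II_loopClass (hF : ∀ p : Fiber F t, ∃ C : FiberChart F t, p ∈ C.domain) {c : Path p p}
    (hc : IsPiecewiseC1 c) : II k η (loopClass c) = chenSeries k η c :=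
  chenSeries_eq_of_homotopic k η hF (isPiecewiseC1_representative hF _) hc
    (homotopic_of_loopClass_eq (loopClass_representative hF _))

theorem isExpansion_II (hF : ∀ p : Fiber F t, ∃ C : FiberChart F t, p ∈ C.domain) :
    IsExpansion (fun a (σ : FundamentalGroup (Fiber F t) p) => period (η a) σ)
      (II k η : FundamentalGroup (Fiber F t) p → Jets n k) where
  map_mul g h := by
    have hg := isPiecewiseC1_representative hF g
    have hh := isPiecewiseC1_representative hF h
    have e : g * h = loopClass ((representative h).trans (representative g)) := by
      rw [loopClass_trans, loopClass_representative hF, loopClass_representative hF]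
    rw [e, II_loopClass k η hF (hh.trans hg), chenSeries_trans k η hF hh hg (hh.trans hg)]
    rfl
  sub_mem g := by
    rw [II, ← chenTransport_one]
    exact wordSeries_sub_mem k
      (I := fun w => iterAux (w.map fun a => pullback (η a) (representative g)) 1) rfl

theorem IsTypical.exists_fiberChart (ht : IsTypical F t) (p : Fiber F t) :
    ∃ C : FiberChart F t, p ∈ C.domain := by
  obtain ⟨U, -, htU, hU, -⟩ := ht
  obtain ⟨j, hj⟩ := hU p.1 (by rwa [p.2])
  exact OrbitDepth.exists_fiberChart p hj

end Expansion

end OrbitDepth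

end

open OrbitDepth in
theorem mainTheorem6 (F : Poly) (t₀ : ℂ) (ht₀ : IsTypical F t₀)
    (hconn : IsConnected {p : Fin 2 → ℂ | MvPolynomial.eval p F = t₀})
    (p₀ : Fiber F t₀)
    (n : ℕ) (η : Fin n → PolyForm) (hη : IsCohomologyBasis η p₀)
    (γ : FundamentalGroup (Fiber F t₀) p₀)
    (k : ℕ) (hk : torsionFreeDepth (orbit F p₀ γ) = (k : ℕ∞)) :
    (∀ σ : FundamentalGroup (Fiber F t₀) p₀, ∃ c : Path p₀ p₀,
      IsPiecewiseC1 c ∧ loopClass c = σ) ∧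
    (∀ c : Path p₀ p₀, IsPiecewiseC1 c → II k η (loopClass c) = chenSeries k η c) ∧
    ∃ Λ : FundamentalGroup (Fiber F t₀) p₀ ⧸ L (FundamentalGroup (Fiber F t₀) p₀) (k + 1) →
        Jets n k,
      (∀ σ : FundamentalGroup (Fiber F t₀) p₀, Λ (QuotientGroup.mk σ) = Jets.log (II k η σ)) ∧
      ∃ e : CH1 (orbit F p₀ γ) ≃ₗ[ℂ] NSpace k η (orbit F p₀ γ),
        ∀ σ : orbit F p₀ γ,
          e (CH1.of (orbit F p₀ γ) σ) =
            Submodule.Quotient.mk (logSpan.of k η (orbit F p₀ γ) σ) := by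
  have hF := ht₀.exists_fiberChart
  have hΦ := isExpansion_II (p := p₀) k η hF
  refine ⟨exists_loopClass_eq hF, fun c hc => II_loopClass k η hF hc, ?_⟩
  obtain ⟨Λ, hΛ⟩ := hΦ.exists_log_quotient
  exact ⟨Λ, hΛ, hΦ.exists_equiv hη (orbit F p₀ γ) hk rfl rfl (logSpan.of k η (orbit F p₀ γ))
    fun _ => rfl⟩
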